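/- Let $q\in L^1[0,1]$ be real-valued and let $t\in[0,2\pi)$ be fixed. Let $L_t(q)$ be the self-adjoint Sturm–Liouville operator in the complex space $L^2[0,1]$ given by $-y''+q(x)y$ on the domain of all $y\in L^2[0,1]$ such that $y$ and $y'$ are absolutely continuous on $[0,1]$, $-y''+qy\in L^2[0,1]$, and $$y(1)=e^{it}y(0),\qquad y'(1)=e^{it}y'(0).$$ If the first (that is, the smallest) eigenvalue of $L_t(q)$ is not less than $\min\{t^2,(2\pi-t)^2\}$, and the spectrum of $L_t(q)$ contains the set $\{(2n\pi-t)^2 : n=1,2,3,\ldots\}$, then $q=0$ almost everywhere on $[0,1]$. (No further condition is imposed on $q$, including in the antiperiodic case $t=\pi$.) -/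

import Mathlib

open MeasureTheory Set

noncomputable section

namespace QuasiPeriodic

/-- The Hilbert space `L²[0,1]` of complex-valued functions. -/
abbrev L2 : Type := Lp ℂ 2 (volume.restrict (Icc (0 : ℝ) 1))

/-- `y` is a function on `[0,1]` with derivative `u` on `[0,1]` (one-sided at the end points), `u` is
absolutely continuous on `[0,1]` (so `y` is `C¹`, in particular absolutely continuous),
`y(1) = e^{it} y(0)` and `y'(1) = e^{it} y'(0)`, and `-y'' + q y = g` almost everywhere
on `[0,1]`. -/
def Solves (t : ℝ) (q : ℝ → ℝ) (y u g : ℝ → ℂ) : Prop :=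
  (∀ x ∈ Icc (0 : ℝ) 1, HasDerivWithinAt y (u x) (Icc 0 1) x) ∧
  AbsolutelyContinuousOnInterval u 0 1 ∧
  y 1 = Complex.exp (Complex.I * t) * y 0 ∧
  u 1 = Complex.exp (Complex.I * t) * u 0 ∧
  ∀ᵐ x ∂(volume.restrict (Icc (0 : ℝ) 1)), ∃ w : ℂ, HasDerivAt u w x ∧ -w + q x * y x = g x

theorem ac_const_mul {u : ℝ → ℂ} (c : ℂ) (hu : AbsolutelyContinuousOnInterval u 0 1) :
    AbsolutelyContinuousOnInterval (fun x => c * u x) 0 1 := by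
  rw [absolutelyContinuousOnInterval_iff] at hu ⊢
  intro ε hε
  obtain ⟨δ, hδ, h⟩ := hu (ε / (‖c‖ + 1)) (by positivity)
  refine ⟨δ, hδ, fun E hE hlt => ?_⟩
  have h1 := h E hE hlt
  have h2 : ∑ i ∈ Finset.range E.1, dist (c * u (E.2 i).1) (c * u (E.2 i).2)
      = ‖c‖ * ∑ i ∈ Finset.range E.1, dist (u (E.2 i).1) (u (E.2 i).2) := by
    rw [Finset.mul_sum]
    refine Finset.sum_congr rfl fun i _ => ?_
    rw [dist_eq_norm, dist_eq_norm, ← mul_sub, norm_mul]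
  rw [h2]
  have h0 : 0 ≤ ∑ i ∈ Finset.range E.1, dist (u (E.2 i).1) (u (E.2 i).2) :=
    Finset.sum_nonneg fun _ _ => dist_nonneg
  rw [lt_div_iff₀ (by positivity)] at h1
  nlinarith [norm_nonneg c]

/-- The graph of `L_t(q)`: the pairs `(f, g)` of elements of `L²[0,1]` such that `f` has a
representative `y` with `y'` absolutely continuous that satisfies the boundary conditions, and
`g = -y'' + q y`. -/
def graph (t : ℝ) (q : ℝ → ℝ) : Submodule ℂ (L2 × L2) where
  carrier := {p | ∃ y u : ℝ → ℂ,
    Solves t q y u p.2 ∧ p.1 =ᵐ[volume.restrict (Icc (0 : ℝ) 1)] y}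
  zero_mem' := by
    refine ⟨fun _ => 0, fun _ => 0, ⟨fun x _ => hasDerivWithinAt_const _ _ _, ?_, by simp, by simp,
      ?_⟩, Lp.coeFn_zero _ _ _⟩
    · have h : AbsolutelyContinuousOnInterval (fun _ : ℝ => (0 : ℂ)) 0 1 := by
        rw [absolutelyContinuousOnInterval_iff]
        intro ε hε
        exact ⟨1, one_pos, fun E _ _ => by simpa using hε⟩
      exact h
    · filter_upwards [Lp.coeFn_zero ℂ 2 (volume.restrict (Icc (0 : ℝ) 1))] with x hx
      exact ⟨0, hasDerivAt_const _ _, by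
        change _ = ((0 : L2) : ℝ → ℂ) x
        rw [hx]; simp⟩
  add_mem' := by
    rintro ⟨f₁, g₁⟩ ⟨f₂, g₂⟩ ⟨y₁, u₁, ⟨hd₁, ha₁, hb₁, hc₁, he₁⟩, hf₁⟩
      ⟨y₂, u₂, ⟨hd₂, ha₂, hb₂, hc₂, he₂⟩, hf₂⟩
    refine ⟨fun x => y₁ x + y₂ x, fun x => u₁ x + u₂ x,
      ⟨fun x hx => (hd₁ x hx).add (hd₂ x hx), ha₁.fun_add ha₂, ?_, ?_, ?_⟩, ?_⟩
    · simp only [hb₁, hb₂]; ring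
    · simp only [hc₁, hc₂]; ring
    · filter_upwards [he₁, he₂, Lp.coeFn_add g₁ g₂] with x h₁ h₂ h
      obtain ⟨w₁, hw₁, e₁⟩ := h₁
      obtain ⟨w₂, hw₂, e₂⟩ := h₂
      refine ⟨w₁ + w₂, hw₁.add hw₂, ?_⟩
      change _ = ((g₁ + g₂ : L2) : ℝ → ℂ) x
      rw [h, Pi.add_apply, ← e₁, ← e₂]; ring
    · filter_upwards [hf₁, hf₂, Lp.coeFn_add f₁ f₂] with x h₁ h₂ h
      change ((f₁ + f₂ : L2) : ℝ → ℂ) x = _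
      rw [h, Pi.add_apply, h₁, h₂]
  smul_mem' := by
    rintro c ⟨f, g⟩ ⟨y, u, ⟨hd, ha, hb, hc, he⟩, hf⟩
    refine ⟨fun x => c * y x, fun x => c * u x,
      ⟨fun x hx => (hd x hx).const_mul c, ac_const_mul c ha, ?_, ?_, ?_⟩, ?_⟩
    · simp only [hb]; ring
    · simp only [hc]; ring
    · filter_upwards [he, Lp.coeFn_smul c g] with x h₁ h
      obtain ⟨w, hw, e⟩ := h₁
      refine ⟨c * w, hw.const_mul c, ?_⟩
      change _ = ((c • g : L2) : ℝ → ℂ) x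
      rw [h, Pi.smul_apply, smul_eq_mul, ← e]; ring
    · filter_upwards [hf, Lp.coeFn_smul c f] with x h₁ h
      change ((c • f : L2) : ℝ → ℂ) x = _
      rw [h, Pi.smul_apply, smul_eq_mul, h₁]

/-- The graph is single-valued: `-y'' + q y` depends only on the class of `y` in `L²[0,1]`. -/
theorem graph_single_valued (t : ℝ) (q : ℝ → ℝ) :
    ∀ p ∈ graph t q, p.1 = 0 → p.2 = 0 := by
  rintro ⟨f, g⟩ ⟨y, u, ⟨hd, -, -, -, he⟩, hf⟩ hf0
  change f = 0 at hf0
  subst hf0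
  have hcont : ContinuousOn y (Icc 0 1) := fun x hx => (hd x hx).continuousWithinAt
  have hy0 : ∀ᵐ x ∂(volume.restrict (Icc (0 : ℝ) 1)), y x = 0 := by
    filter_upwards [hf, Lp.coeFn_zero ℂ 2 (volume.restrict (Icc (0 : ℝ) 1))] with x h₁ h₂
    rw [← h₁]; exact h₂
  have hy : EqOn y (fun _ => 0) (Icc (0 : ℝ) 1) :=
    Measure.eqOn_Icc_of_ae_eq volume zero_ne_one hy0 hcont continuousOn_const
  have hu : ∀ x ∈ Icc (0 : ℝ) 1, u x = 0 := fun x hx =>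
    ((uniqueDiffOn_Icc zero_lt_one) x hx).eq_deriv _ (hd x hx)
      ((hasDerivWithinAt_const x _ (0 : ℂ)).congr hy (hy hx))
  apply Lp.ext
  refine Filter.EventuallyEq.trans ?_ (Lp.coeFn_zero _ _ _).symm
  have hIoo : ∀ᵐ x ∂(volume.restrict (Icc (0 : ℝ) 1)), x ∈ Ioo (0 : ℝ) 1 := by
    rw [← Measure.restrict_congr_set (Ioo_ae_eq_Icc (μ := volume) (a := (0 : ℝ)) (b := 1))]
    exact ae_restrict_mem measurableSet_Ioo
  filter_upwards [he, hIoo] with x h hx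
  obtain ⟨w, hw, e⟩ := h
  have hw0 : w = 0 := by
    refine hw.unique ((hasDerivAt_const x (0 : ℂ)).congr_of_eventuallyEq ?_)
    filter_upwards [Ioo_mem_nhds hx.1 hx.2] with z hz
    exact hu z (Ioo_subset_Icc_self hz)
  change g x = 0
  rw [← e, hw0, hy (Ioo_subset_Icc_self hx)]
  simp

/-- The Sturm-Liouville operator `L_t(q)`, as an unbounded operator in `L²[0,1]`. -/
def L (t : ℝ) (q : ℝ → ℝ) : L2 →ₗ.[ℂ] L2 := (graph t q).toLinearPMap

theorem L_graph (t : ℝ) (q : ℝ → ℝ) : (L t q).graph = graph t q :=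
  Submodule.toLinearPMap_graph_eq _ (graph_single_valued t q)

/-- The resolvent set of an unbounded operator `A`: all complex `z` for which `A - z`, from the
domain of `A` to the whole space, has a bounded everywhere defined two-sided inverse. -/
def resolventSet (A : L2 →ₗ.[ℂ] L2) : Set ℂ :=
  {z | ∃ R : L2 →L[ℂ] L2,
    (∀ h : L2, ∃ f : A.domain, (f : L2) = R h ∧ A f - z • (f : L2) = h) ∧
    ∀ f : A.domain, R (A f - z • (f : L2)) = f}

/-- The spectrum of an unbounded operator. -/
def spectrum (A : L2 →ₗ.[ℂ] L2) : Set ℂ := (resolventSet A)ᶜ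

/-- The set of real eigenvalues of an unbounded operator (all its eigenvalues, if it is
self-adjoint). -/
def eigenvalues (A : L2 →ₗ.[ℂ] L2) : Set ℝ :=
  {lam | ∃ f : A.domain, (f : L2) ≠ 0 ∧ A f = (lam : ℂ) • (f : L2)}

/-- `lam` is the first (that is, the smallest) eigenvalue of `A`. -/
def IsFirstEigenvalue (A : L2 →ₗ.[ℂ] L2) (lam : ℝ) : Prop := IsLeast (eigenvalues A) lam

end QuasiPeriodic

end

noncomputable section

namespace QuasiPeriodic

open scoped ComplexConjugate

/-! The argument is of Ambarzumyan type: the high eigenvalues force `q` to have mean zero, and the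
lowest one then makes an exponential an extremal of the quadratic form, which leaves room only for
`q = 0`.

Mean zero (`integral_eq_zero_of_spectrum`). Put `k = 2nπ - t`, so that `e^{ik} e^{it} = 1`. An
eigenfunction for `k²`, normalized in the supremum norm, is `a e^{ikx} + b e^{-ikx}` up to `O(1/k)`.
Variation of constants over the whole interval gives `∫ e^{ikx} q y = 0`, hence `b ∫ q + a q̂(2k) =
O(1/k)`. If `e^{2it} ≠ 1`, then `a` tends to zero and `|b|` stays away from it. If `e^{2it} = 1`,
the same relation holds with `a` and `b` exchanged and `-k` for `k`; the one in which the larger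
coefficient multiplies `∫ q` is used, and the Riemann–Lebesgue lemma removes the other term. Letting
`n → ∞` gives `∫ q = 0` in both cases.

Rigidity. Choose `τ` with `τ² = min (t²) ((2π - t)²)` and `e^{iτ} = e^{it}`. As `∫ q = 0`, the form
of `L_t(q)` takes the value `τ²` on the unit vector `e^{iτx}`, while the first eigenvalue is at
least `τ²`. So `e^{iτx}` is an eigenfunction, and inserting it into the equation gives `q = 0`.

Both halves rest on `exists_compact_resolvent`: wherever the homogeneous problem has only the
trivial solution there is a compact resolvent. Hence points of the spectrum have eigenfunctions
(`exists_solution_of_mem_spectrum`). At a point `-c` where the shifted form dominates the `L²` norm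
(`exists_form_lower_bound`), the resolvent `R` is nonnegative, and the first eigenvalue exists and
equals `‖R‖⁻¹ - c` (`isFirstEigenvalue_of_resolvent`). -/

/-! ### Absolutely continuous functions on the unit interval. -/

theorem intervalIntegrable_zero_one_iff {E : Type*} [NormedAddCommGroup E] {f : ℝ → E} :
    IntervalIntegrable f volume 0 1 ↔ IntegrableOn f (Icc (0 : ℝ) 1) :=
  intervalIntegrable_iff_integrableOn_Icc_of_le zero_le_one

theorem norm_integral_sub_le {h : ℝ → ℂ} (hh : IntervalIntegrable h volume 0 1) {a b : ℝ}
    (ha : a ∈ Icc (0 : ℝ) 1) (hb : b ∈ Icc (0 : ℝ) 1) :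
    ‖(∫ s in (0 : ℝ)..a, h s) - ∫ s in (0 : ℝ)..b, h s‖ ≤
      |(∫ s in (0 : ℝ)..a, ‖h s‖) - ∫ s in (0 : ℝ)..b, ‖h s‖| := by
  have hs : ∀ c ∈ Icc (0 : ℝ) 1, uIcc 0 c ⊆ uIcc (0 : ℝ) 1 := fun c hc => by
    rw [uIcc_of_le hc.1, uIcc_of_le zero_le_one]
    exact Icc_subset_Icc_right hc.2
  rw [intervalIntegral.integral_interval_sub_left (hh.mono_set (hs a ha)) (hh.mono_set (hs b hb)),
    intervalIntegral.integral_interval_sub_left (hh.norm.mono_set (hs a ha))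
      (hh.norm.mono_set (hs b hb))]
  exact intervalIntegral.norm_integral_le_abs_integral_norm

/-- Increments of the primitive of `h` are dominated by those of the primitive of `‖h‖`, so the same
`δ` serves for both. -/
theorem ac_integral {h : ℝ → ℂ} (hh : IntervalIntegrable h volume 0 1) :
    AbsolutelyContinuousOnInterval (fun x => ∫ s in (0 : ℝ)..x, h s) 0 1 := by
  have hI : uIcc (0 : ℝ) 1 = Icc 0 1 := uIcc_of_le zero_le_one
  have hG := hh.norm.absolutelyContinuousOnInterval_intervalIntegral
    (c := 0) left_mem_uIcc
  rw [absolutelyContinuousOnInterval_iff] at hG ⊢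
  intro ε hε
  obtain ⟨δ, hδ, H⟩ := hG ε hε
  refine ⟨δ, hδ, fun E hE hlt => lt_of_le_of_lt (Finset.sum_le_sum fun i hi => ?_) (H E hE hlt)⟩
  have h1 := hE.1 i hi
  rw [hI] at h1
  rw [dist_eq_norm, Real.dist_eq]
  exact norm_integral_sub_le hh h1.1 h1.2

/-- The difference of `f` and the primitive of `f'` is absolutely continuous with derivative zero
almost everywhere, hence constant. -/
theorem eq_add_integral_of_ac {f f' : ℝ → ℂ} (hf : AbsolutelyContinuousOnInterval f 0 1)
    (hf' : IntervalIntegrable f' volume 0 1)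
    (hd : ∀ᵐ x ∂(volume.restrict (Icc (0 : ℝ) 1)), HasDerivAt f (f' x) x) :
    ∀ x ∈ Icc (0 : ℝ) 1, f x = f 0 + ∫ s in (0 : ℝ)..x, f' s := by
  have hI : uIcc (0 : ℝ) 1 = Icc 0 1 := uIcc_of_le zero_le_one
  have hF : AbsolutelyContinuousOnInterval (fun x => ∫ s in (0 : ℝ)..x, f' s) 0 1 :=
    ac_integral hf'
  have hg : AbsolutelyContinuousOnInterval (fun x => f x - ∫ s in (0 : ℝ)..x, f' s) 0 1 :=
    hf.fun_sub hF
  rw [ae_restrict_iff' measurableSet_Icc] at hd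
  have hz : ∀ᵐ x, x ∈ uIcc (0 : ℝ) 1 →
      HasDerivAt (fun x => f x - ∫ s in (0 : ℝ)..x, f' s) 0 x := by
    filter_upwards [hd, hf'.ae_hasDerivAt_integral] with x h1 h2 h3
    have h4 := h2 h3 0 left_mem_uIcc
    rw [hI] at h3
    have h5 := (h1 h3).fun_sub h4
    rwa [sub_self] at h5
  obtain ⟨C, hC⟩ := hg.const_of_ae_hasDerivAt_zero hz
  intro x hx
  rw [hI] at hC
  have h1 := hC x hx
  have h0 := hC 0 (left_mem_Icc.2 zero_le_one)
  rw [intervalIntegral.integral_same, sub_zero] at h0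
  rw [h0, ← h1, sub_add_cancel]

theorem hasDerivWithinAt_of_eq_integral {f f' : ℝ → ℂ} (hf' : ContinuousOn f' (Icc (0 : ℝ) 1))
    (h : ∀ x ∈ Icc (0 : ℝ) 1, f x = f 0 + ∫ s in (0 : ℝ)..x, f' s) :
    ∀ x ∈ Icc (0 : ℝ) 1, HasDerivWithinAt f (f' x) (Icc 0 1) x := by
  intro x hx
  -- Extending `f'` by its end values makes it continuous on the line, so the fundamental theorem
  -- also covers the end points.
  set F : ℝ → ℂ := IccExtend (zero_le_one' ℝ) ((Icc (0 : ℝ) 1).domRestrict f') with hF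
  have hFc : Continuous F := (continuousOn_iff_continuous_domRestrict.1 hf').Icc_extend'
  have hFe : ∀ s ∈ Icc (0 : ℝ) 1, F s = f' s := fun s hs => by
    rw [hF, IccExtend_of_mem _ _ hs]; rfl
  have hd : HasDerivAt (fun x => f 0 + ∫ s in (0 : ℝ)..x, F s) (F x) x :=
    (hFc.integral_hasStrictDerivAt 0 x).hasDerivAt.const_add _
  rw [← hFe x hx]
  refine hd.hasDerivWithinAt.congr_of_mem (fun z hz => ?_) hx
  rw [h z hz]
  congr 1
  refine intervalIntegral.integral_congr fun s hs => ?_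
  rw [uIcc_of_le hz.1] at hs
  exact (hFe s ⟨hs.1, hs.2.trans hz.2⟩).symm

theorem ac_of_hasDerivWithinAt {y u : ℝ → ℂ}
    (hy : ∀ x ∈ Icc (0 : ℝ) 1, HasDerivWithinAt y (u x) (Icc 0 1) x)
    (hu : ContinuousOn u (Icc (0 : ℝ) 1)) : AbsolutelyContinuousOnInterval y 0 1 := by
  obtain ⟨C, hC⟩ := isCompact_Icc.exists_bound_of_continuousOn hu
  refine LipschitzOnWith.absolutelyContinuousOnInterval (K := C.toNNReal) ?_
  rw [uIcc_of_le zero_le_one]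
  refine (convex_Icc (0 : ℝ) 1).lipschitzOnWith_of_nnnorm_hasDerivWithin_le hy fun x hx => ?_
  rw [← NNReal.coe_le_coe]
  exact (hC x hx).trans (Real.le_coe_toNNReal C)

theorem ae_mem_Ioo : ∀ᵐ x ∂(volume.restrict (Icc (0 : ℝ) 1)), x ∈ Ioo (0 : ℝ) 1 := by
  rw [← Measure.restrict_congr_set (Ioo_ae_eq_Icc (μ := volume) (a := (0 : ℝ)) (b := 1))]
  exact ae_restrict_mem measurableSet_Ioo

/-! ### Quasi-periodic functions and integration by parts. -/

/-- `y` is continuously differentiable on `[0,1]` with derivative `u`. -/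
def IsC1 (y u : ℝ → ℂ) : Prop :=
  (∀ x ∈ Icc (0 : ℝ) 1, HasDerivWithinAt y (u x) (Icc 0 1) x) ∧ ContinuousOn u (Icc (0 : ℝ) 1)

theorem IsC1.continuousOn {y u : ℝ → ℂ} (h : IsC1 y u) : ContinuousOn y (Icc (0 : ℝ) 1) :=
  fun x hx => (h.1 x hx).continuousWithinAt

theorem IsC1.ac {y u : ℝ → ℂ} (h : IsC1 y u) : AbsolutelyContinuousOnInterval y 0 1 :=
  ac_of_hasDerivWithinAt h.1 h.2

theorem IsC1.ae_hasDerivAt {y u : ℝ → ℂ} (h : IsC1 y u) :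
    ∀ᵐ x ∂(volume.restrict (Icc (0 : ℝ) 1)), HasDerivAt y (u x) x := by
  filter_upwards [ae_mem_Ioo] with x hx
  exact (h.1 x (Ioo_subset_Icc_self hx)).hasDerivAt (Icc_mem_nhds hx.1 hx.2)

theorem IsC1.conj {y u : ℝ → ℂ} (h : IsC1 y u) :
    IsC1 (fun x => conj (y x)) (fun x => conj (u x)) :=
  ⟨fun x hx => (h.1 x hx).star, Complex.continuous_conj.comp_continuousOn h.2⟩

theorem IsC1.sub {y u y' u' : ℝ → ℂ} (h : IsC1 y u) (h' : IsC1 y' u') :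
    IsC1 (fun x => y x - y' x) (fun x => u x - u' x) :=
  ⟨fun x hx => (h.1 x hx).sub (h'.1 x hx), h.2.sub h'.2⟩

theorem IsC1.const_mul {y u : ℝ → ℂ} (c : ℂ) (h : IsC1 y u) :
    IsC1 (fun x => c * y x) (fun x => c * u x) :=
  ⟨fun x hx => (h.1 x hx).const_mul c, h.2.const_mul c⟩

/-- A quasi-periodic `y` with derivative `u`, where `u` is absolutely continuous with almost
everywhere derivative `w`. -/
structure SecondDeriv (t : ℝ) (y u w : ℝ → ℂ) : Prop where
  deriv : ∀ x ∈ Icc (0 : ℝ) 1, HasDerivWithinAt y (u x) (Icc 0 1) x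
  ac : AbsolutelyContinuousOnInterval u 0 1
  bc : y 1 = Complex.exp (Complex.I * t) * y 0
  bc' : u 1 = Complex.exp (Complex.I * t) * u 0
  ae : ∀ᵐ x ∂(volume.restrict (Icc (0 : ℝ) 1)), HasDerivAt u (w x) x

theorem SecondDeriv.isC1 {t : ℝ} {y u w : ℝ → ℂ} (h : SecondDeriv t y u w) : IsC1 y u :=
  ⟨h.deriv, by simpa [uIcc_of_le] using h.ac.continuousOn⟩

/-- Replaces the pointwise existential second derivative by the function `q y - g`, which can be
integrated. -/
theorem solves_iff {t : ℝ} {q : ℝ → ℝ} {y u g : ℝ → ℂ} :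
    Solves t q y u g ↔ SecondDeriv t y u (fun x => q x * y x - g x) := by
  constructor
  · rintro ⟨h1, h2, h3, h4, h5⟩
    refine ⟨h1, h2, h3, h4, ?_⟩
    filter_upwards [h5] with x hx
    obtain ⟨w, hw, e⟩ := hx
    rwa [← e, show (q x : ℂ) * y x - (-w + q x * y x) = w by ring]
  · rintro ⟨h1, h2, h3, h4, h5⟩
    refine ⟨h1, h2, h3, h4, ?_⟩
    filter_upwards [h5] with x hx
    exact ⟨_, hx, by ring⟩

theorem SecondDeriv.congr_ae {t : ℝ} {y u w w' : ℝ → ℂ} (h : SecondDeriv t y u w)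
    (hw : ∀ᵐ x ∂(volume.restrict (Icc (0 : ℝ) 1)), w x = w' x) : SecondDeriv t y u w' := by
  refine ⟨h.deriv, h.ac, h.bc, h.bc', ?_⟩
  filter_upwards [h.ae, hw] with x h1 h2
  rwa [← h2]

theorem SecondDeriv.sub {t : ℝ} {y u w y' u' w' : ℝ → ℂ} (h : SecondDeriv t y u w)
    (h' : SecondDeriv t y' u' w') :
    SecondDeriv t (fun x => y x - y' x) (fun x => u x - u' x) (fun x => w x - w' x) := by
  refine ⟨fun x hx => (h.deriv x hx).sub (h'.deriv x hx), h.ac.fun_sub h'.ac, ?_, ?_, ?_⟩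
  · simp only [h.bc, h'.bc]; ring
  · simp only [h.bc', h'.bc']; ring
  · filter_upwards [h.ae, h'.ae] with x h1 h2
    exact h1.sub h2

theorem SecondDeriv.const_mul {t : ℝ} {y u w : ℝ → ℂ} (c : ℂ) (h : SecondDeriv t y u w) :
    SecondDeriv t (fun x => c * y x) (fun x => c * u x) (fun x => c * w x) := by
  refine ⟨fun x hx => (h.deriv x hx).const_mul c, ac_const_mul c h.ac, ?_, ?_, ?_⟩
  · simp only [h.bc]; ring
  · simp only [h.bc']; ring
  · filter_upwards [h.ae] with x h1
    exact h1.const_mul c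

theorem exp_mul_conj (t : ℝ) :
    Complex.exp (Complex.I * t) * conj (Complex.exp (Complex.I * t)) = 1 := by
  rw [Complex.mul_conj, Complex.normSq_eq_norm_sq, mul_comm Complex.I, Complex.norm_exp_ofReal_mul_I]
  simp

/-- Integration by parts: the boundary terms cancel. -/
theorem SecondDeriv.integral_mul_conj {t : ℝ} {y u w y' u' : ℝ → ℂ} (h : SecondDeriv t y u w)
    (hw : IntervalIntegrable w volume 0 1) (h' : IsC1 y' u')
    (hb : y' 1 = Complex.exp (Complex.I * t) * y' 0) :
    ∫ x in (0 : ℝ)..1, w x * conj (y' x) = - ∫ x in (0 : ℝ)..1, u x * conj (u' x) := by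
  have hI : uIcc (0 : ℝ) 1 = Icc 0 1 := uIcc_of_le zero_le_one
  have hc := h'.conj
  have i1 : IntervalIntegrable (fun x => w x * conj (y' x)) volume 0 1 :=
    hw.mul_continuousOn (by rw [hI]; exact hc.continuousOn)
  have i2 : IntervalIntegrable (fun x => u x * conj (u' x)) volume 0 1 :=
    ContinuousOn.intervalIntegrable (by rw [hI]; exact h.isC1.2.mul hc.2)
  have ha : AbsolutelyContinuousOnInterval (fun x => u x * conj (y' x)) 0 1 :=
    h.ac.fun_smul hc.ac
  have := eq_add_integral_of_ac ha (i1.add i2) (by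
    filter_upwards [h.ae, hc.ae_hasDerivAt] with x h1 h2 using h1.mul h2) 1 (by simp)
  have e : u 1 * conj (y' 1) = u 0 * conj (y' 0) := by
    rw [h.bc', hb, map_mul]
    linear_combination u 0 * conj (y' 0) * exp_mul_conj t
  rw [intervalIntegral.integral_add i1 i2, e] at this
  linear_combination -this

/-! ### Green's operator of `-y'' + y`. -/

/-- The solution of `-y'' + y = h` with quasi-periodic boundary conditions, in terms of
`P x = ∫₀ˣ e⁻ˢ h` and `M x = ∫₀ˣ eˢ h`. The derivative has `σ = -1`, the solution `σ = 1`. -/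
def greenForm (t : ℝ) (σ : ℂ) (P M : ℝ → ℂ) (x : ℝ) : ℂ :=
  (1 / 2) * (Complex.exp x * (Complex.exp 1 / (Complex.exp 1 - Complex.exp (Complex.I * t)) * P 1
      - P x)
    + σ * (Complex.exp (-x) *
      (M x + 1 / (Complex.exp 1 * Complex.exp (Complex.I * t) - 1) * M 1)))

/-- `∫₀ˣ e^{cs} h(s) ds`. -/
def expIntegral (c : ℝ) (h : ℝ → ℂ) (x : ℝ) : ℂ := ∫ s in (0 : ℝ)..x, Complex.exp (c * s) * h s

/-- The solution of `-y'' + y = h` with quasi-periodic boundary conditions. -/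
def green (t : ℝ) (h : ℝ → ℂ) : ℝ → ℂ := greenForm t 1 (expIntegral (-1) h) (expIntegral 1 h)

/-- The derivative of `green`. -/
def greenDeriv (t : ℝ) (h : ℝ → ℂ) : ℝ → ℂ :=
  greenForm t (-1) (expIntegral (-1) h) (expIntegral 1 h)

theorem norm_exp_one_gt : 1 < ‖Complex.exp 1‖ := by
  rw [Complex.norm_exp]; simp

theorem norm_exp_I_mul (t : ℝ) : ‖Complex.exp (Complex.I * t)‖ = 1 := by
  rw [mul_comm, Complex.norm_exp_ofReal_mul_I]

theorem exp_one_sub_ne (t : ℝ) : Complex.exp 1 - Complex.exp (Complex.I * t) ≠ 0 := by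
  intro h
  have := congrArg norm (sub_eq_zero.1 h)
  rw [norm_exp_I_mul] at this
  linarith [norm_exp_one_gt]

theorem exp_one_mul_sub_ne (t : ℝ) : Complex.exp 1 * Complex.exp (Complex.I * t) - 1 ≠ 0 := by
  intro h
  have := congrArg norm (sub_eq_zero.1 h)
  rw [norm_mul, norm_exp_I_mul, mul_one, norm_one] at this
  linarith [norm_exp_one_gt]

theorem intervalIntegrable_exp_mul (c : ℝ) {h : ℝ → ℂ} (hh : IntervalIntegrable h volume 0 1) :
    IntervalIntegrable (fun s : ℝ => Complex.exp (c * s) * h s) volume 0 1 :=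
  hh.continuousOn_mul (by fun_prop)

theorem ac_expIntegral (c : ℝ) {h : ℝ → ℂ} (hh : IntervalIntegrable h volume 0 1) :
    AbsolutelyContinuousOnInterval (expIntegral c h) 0 1 :=
  ac_integral (intervalIntegrable_exp_mul c hh)

theorem ae_hasDerivAt_expIntegral (c : ℝ) {h : ℝ → ℂ} (hh : IntervalIntegrable h volume 0 1) :
    ∀ᵐ x ∂(volume.restrict (Icc (0 : ℝ) 1)),
      HasDerivAt (expIntegral c h) (Complex.exp (c * (x : ℝ)) * h x) x := by
  rw [ae_restrict_iff' measurableSet_Icc]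
  filter_upwards [(intervalIntegrable_exp_mul c hh).ae_hasDerivAt_integral] with x h1 h2
  exact h1 (by rwa [uIcc_of_le zero_le_one]) 0 left_mem_uIcc

theorem ac_exp (c : ℂ) : AbsolutelyContinuousOnInterval (fun x : ℝ => Complex.exp (c * x)) 0 1 := by
  refine ac_of_hasDerivWithinAt (u := fun x : ℝ => Complex.exp (c * x) * c) (fun x _ => ?_)
    (by fun_prop)
  have h := (((hasDerivAt_id (x : ℂ)).const_mul c).cexp).comp_ofReal
  simpa using h.hasDerivWithinAt

theorem hasDerivAt_exp_mul (c : ℂ) (x : ℝ) :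
    HasDerivAt (fun x : ℝ => Complex.exp (c * x)) (Complex.exp (c * x) * c) x := by
  simpa using (((hasDerivAt_id (x : ℂ)).const_mul c).cexp).comp_ofReal

theorem ac_const (c : ℂ) : AbsolutelyContinuousOnInterval (fun _ : ℝ => c) 0 1 :=
  ac_of_hasDerivWithinAt (u := fun _ => 0) (fun x _ => hasDerivWithinAt_const x _ c)
    continuousOn_const

theorem greenForm_eq (t : ℝ) (σ : ℂ) (P M : ℝ → ℂ) : greenForm t σ P M = fun x : ℝ =>
    (1 / 2) * (Complex.exp (1 * x) *
      (Complex.exp 1 / (Complex.exp 1 - Complex.exp (Complex.I * t)) * P 1 - P x)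
    + σ * (Complex.exp (-1 * x) *
      (M x + 1 / (Complex.exp 1 * Complex.exp (Complex.I * t) - 1) * M 1))) := by
  funext x
  simp [greenForm]

theorem ac_greenForm (t : ℝ) (σ : ℂ) {h : ℝ → ℂ} (hh : IntervalIntegrable h volume 0 1) :
    AbsolutelyContinuousOnInterval (greenForm t σ (expIntegral (-1) h) (expIntegral 1 h)) 0 1 := by
  rw [greenForm_eq]
  exact ac_const_mul _ (((ac_exp 1).fun_smul ((ac_const _).fun_sub (ac_expIntegral _ hh))).fun_add
    (ac_const_mul _ ((ac_exp (-1)).fun_smul ((ac_expIntegral _ hh).fun_add (ac_const _)))))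

/-- Differentiation flips the sign of `σ`, and the contributions of `P'` and `M'` combine to `(σ -
1) / 2 * h`: they cancel for `σ = 1`, so `green` is `C¹`, and give `-h` for `σ = -1`. -/
theorem ae_hasDerivAt_greenForm (t : ℝ) (σ : ℂ) {h : ℝ → ℂ}
    (hh : IntervalIntegrable h volume 0 1) :
    ∀ᵐ x ∂(volume.restrict (Icc (0 : ℝ) 1)),
      HasDerivAt (greenForm t σ (expIntegral (-1) h) (expIntegral 1 h))
        (greenForm t (-σ) (expIntegral (-1) h) (expIntegral 1 h) x + (σ - 1) / 2 * h x) x := by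
  filter_upwards [ae_hasDerivAt_expIntegral (-1) hh, ae_hasDerivAt_expIntegral 1 hh] with x h1 h2
  rw [greenForm_eq, greenForm_eq]
  have h3 := (((hasDerivAt_exp_mul 1 x).mul (h1.const_sub (Complex.exp 1 /
    (Complex.exp 1 - Complex.exp (Complex.I * t)) * expIntegral (-1) h 1))).add
    (((hasDerivAt_exp_mul (-1) x).mul (h2.add_const
      (1 / (Complex.exp 1 * Complex.exp (Complex.I * t) - 1) * expIntegral 1 h 1))).const_mul
        σ)).const_mul (1 / 2)
  refine h3.congr_deriv ?_
  have e : Complex.exp (1 * x) * Complex.exp (-1 * x) = 1 := by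
    rw [← Complex.exp_add]; simp
  push_cast
  linear_combination (-1 / 2 + σ / 2) * h x * e

/-- The coefficients of `P 1` and `M 1` are those for which the `e^x` part and the `e^{-x}` part
satisfy the boundary condition separately. Their denominators do not vanish, since `e > 1 =
|e^{it}|`. -/
theorem greenForm_bc (t : ℝ) (σ : ℂ) {P M : ℝ → ℂ} (hP : P 0 = 0) (hM : M 0 = 0) :
    greenForm t σ P M 1 = Complex.exp (Complex.I * t) * greenForm t σ P M 0 := by
  have h1 := exp_one_sub_ne t
  have h2 := exp_one_mul_sub_ne t
  have h3 := Complex.exp_ne_zero 1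
  simp only [greenForm, hP, hM, Complex.ofReal_one, Complex.ofReal_zero, neg_zero, Complex.exp_zero,
    Complex.exp_neg]
  field_simp
  ring

theorem green_secondDeriv (t : ℝ) {h : ℝ → ℂ} (hh : IntervalIntegrable h volume 0 1) :
    SecondDeriv t (green t h) (greenDeriv t h) (fun x => green t h x - h x) := by
  have h0 : ∀ c, expIntegral c h 0 = 0 := fun c => by simp [expIntegral]
  have hac := ac_greenForm t (-1) hh
  have hc : ContinuousOn (greenDeriv t h) (Icc (0 : ℝ) 1) := by
    simpa [uIcc_of_le, greenDeriv] using hac.continuousOn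
  refine ⟨hasDerivWithinAt_of_eq_integral hc (eq_add_integral_of_ac (ac_greenForm t 1 hh)
    (ContinuousOn.intervalIntegrable (by rwa [uIcc_of_le zero_le_one])) ?_), hac,
    greenForm_bc t 1 (h0 _) (h0 _), greenForm_bc t (-1) (h0 _) (h0 _), ?_⟩
  · filter_upwards [ae_hasDerivAt_greenForm t 1 hh] with x hx
    have e : greenDeriv t h x = greenForm t (-1) (expIntegral (-1) h) (expIntegral 1 h) x
        + (1 - 1) / 2 * h x := by rw [greenDeriv]; ring
    rw [e]
    exact hx
  · filter_upwards [ae_hasDerivAt_greenForm t (-1) hh] with x hx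
    refine hx.congr_deriv ?_
    rw [green, neg_neg]; ring

/-! ### Semiboundedness of the quadratic form. -/

/-- The quadratic form of a Sturm-Liouville operator controls the `L²` norm after a shift. -/
theorem exists_form_lower_bound {q : ℝ → ℝ} (hq : IntervalIntegrable q volume 0 1) :
    ∃ c : ℝ, 1 ≤ c ∧ ∀ y u : ℝ → ℂ, IsC1 y u →
      ∫ x in (0 : ℝ)..1, ‖y x‖ ^ 2 ≤
        ∫ x in (0 : ℝ)..1, (‖u x‖ ^ 2 + (q x + c) * ‖y x‖ ^ 2) := by
  have hI : uIcc (0 : ℝ) 1 = Icc 0 1 := uIcc_of_le zero_le_one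
  set N : ℝ := ∫ x in (0 : ℝ)..1, |q x| with hN
  have hN0 : 0 ≤ N := intervalIntegral.integral_nonneg zero_le_one fun x _ => abs_nonneg _
  -- Integrating the bound `hsup` below, divided by `N + 1`, against `|q|` shows that the potential
  -- costs at most `N / (N + 1) * U + N * (N + 2) * Y`. The first term is absorbed by `U`, the
  -- second by the shift, whose summand `1` leaves `Y`.
  refine ⟨N * (N + 2) + 1, by nlinarith, fun y u h => ?_⟩
  have cy : ContinuousOn (fun x => ‖y x‖ ^ 2) (uIcc (0 : ℝ) 1) := by
    rw [hI]; exact h.continuousOn.norm.pow 2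
  have cu : ContinuousOn (fun x => ‖u x‖ ^ 2) (uIcc (0 : ℝ) 1) := by
    rw [hI]; exact h.2.norm.pow 2
  have iy := cy.intervalIntegrable (μ := volume)
  have iu := cu.intervalIntegrable (μ := volume)
  set Y := ∫ x in (0 : ℝ)..1, ‖y x‖ ^ 2 with hY
  set U := ∫ x in (0 : ℝ)..1, ‖u x‖ ^ 2 with hU
  have hY0 : 0 ≤ Y := intervalIntegral.integral_nonneg zero_le_one fun x _ => by positivity
  have hU0 : 0 ≤ U := intervalIntegral.integral_nonneg zero_le_one fun x _ => by positivity
  -- On an interval of length one the minimum of `‖y‖²` is at most its integral; the supremum is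
  -- reached from there by integrating the derivative of `‖y‖²`.
  obtain ⟨a, ha, hamin⟩ := isCompact_Icc.exists_isMinOn (nonempty_Icc.2 (zero_le_one' ℝ)) (hI ▸ cy)
  have hmin : ‖y a‖ ^ 2 ≤ Y := by
    have := intervalIntegral.integral_mono_on zero_le_one (μ := volume)
      (f := fun _ => ‖y a‖ ^ 2) (by simp) iy fun x hx => hamin hx
    simpa using this
  -- the supremum bound
  have hsup : ∀ x ∈ Icc (0 : ℝ) 1, (N + 1) * ‖y x‖ ^ 2 ≤ (N + 1) * Y + (U + (N + 1) ^ 2 * Y) := by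
    intro x hx
    have hsub : uIcc a x ⊆ Icc (0 : ℝ) 1 := (convex_Icc (0 : ℝ) 1).ordConnected.uIcc_subset ha hx
    have hd : ∀ s ∈ Ioo (min a x) (max a x),
        HasDerivAt (fun s => y s * conj (y s)) (u s * conj (y s) + y s * conj (u s)) s := by
      intro s hs
      have hs' : Icc (0 : ℝ) 1 ∈ nhds s := Filter.mem_of_superset (Icc_mem_nhds hs.1 hs.2) hsub
      have hsm := mem_of_mem_nhds hs'
      exact ((h.1 s hsm).hasDerivAt hs').mul ((h.conj.1 s hsm).hasDerivAt hs')
    have cc : ContinuousOn (fun s => u s * conj (y s) + y s * conj (u s)) (Icc (0 : ℝ) 1) :=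
      (h.2.mul h.conj.continuousOn).add (h.continuousOn.mul h.conj.2)
    have hF := intervalIntegral.integral_eq_sub_of_hasDeriv_right
      ((h.continuousOn.mul h.conj.continuousOn).mono hsub)
      (fun s hs => (hd s hs).hasDerivWithinAt) ((cc.mono hsub).intervalIntegrable)
    have hb : ‖∫ s in a..x, (u s * conj (y s) + y s * conj (u s))‖ * (N + 1) ≤
        U + (N + 1) ^ 2 * Y := by
      have i1 : IntervalIntegrable (fun s => ‖u s‖ ^ 2 + (N + 1) ^ 2 * ‖y s‖ ^ 2) volume 0 1 :=
        iu.add (iy.const_mul _)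
      calc _ = ‖∫ s in a..x, (u s * conj (y s) + y s * conj (u s)) * (N + 1 : ℝ)‖ := by
            rw [intervalIntegral.integral_mul_const, norm_mul, Complex.norm_real, Real.norm_eq_abs,
              abs_of_nonneg (by positivity)]
        _ ≤ ∫ s in uIoc a x, ‖(u s * conj (y s) + y s * conj (u s)) * (N + 1 : ℝ)‖ :=
            intervalIntegral.norm_integral_le_integral_norm_uIoc
        _ ≤ ∫ s in Icc (0 : ℝ) 1, ‖(u s * conj (y s) + y s * conj (u s)) * (N + 1 : ℝ)‖ := by
            refine setIntegral_mono_set ?_ (Filter.Eventually.of_forall fun _ => norm_nonneg _)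
              (uIoc_subset_uIcc.trans hsub).eventuallyLE
            exact ((cc.mul continuousOn_const).norm).integrableOn_Icc
        _ ≤ ∫ s in Icc (0 : ℝ) 1, (‖u s‖ ^ 2 + (N + 1) ^ 2 * ‖y s‖ ^ 2) := by
            refine setIntegral_mono_on ((cc.mul continuousOn_const).norm).integrableOn_Icc
              (intervalIntegrable_zero_one_iff.1 i1) measurableSet_Icc fun s _ => ?_
            have e1 : ‖u s * conj (y s) + y s * conj (u s)‖ ≤ 2 * (‖u s‖ * ‖y s‖) := by
              refine (norm_add_le _ _).trans (le_of_eq ?_)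
              simp only [norm_mul, RCLike.norm_conj]; ring
            rw [norm_mul, Complex.norm_real, Real.norm_eq_abs, abs_of_nonneg (by positivity)]
            nlinarith [sq_nonneg (‖u s‖ - (N + 1) * ‖y s‖)]
        _ = U + (N + 1) ^ 2 * Y := by
            rw [integral_Icc_eq_integral_Ioc, ← intervalIntegral.integral_of_le zero_le_one,
              intervalIntegral.integral_add iu (iy.const_mul _),
              intervalIntegral.integral_const_mul]
    have e2 : ‖y x‖ ^ 2 ≤ ‖y a‖ ^ 2 + ‖∫ s in a..x, (u s * conj (y s) + y s * conj (u s))‖ := by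
      have e3 : ∀ s, ‖y s‖ ^ 2 = ‖y s * conj (y s)‖ := fun s => by
        rw [norm_mul, RCLike.norm_conj]; ring
      rw [hF, e3, e3]
      have := norm_add_le (y a * conj (y a)) (y x * conj (y x) - y a * conj (y a))
      rwa [add_sub_cancel] at this
    nlinarith
  have iq : IntervalIntegrable (fun x => q x * ‖y x‖ ^ 2) volume 0 1 := hq.mul_continuousOn cy
  have hsplit : ∫ x in (0 : ℝ)..1, (‖u x‖ ^ 2 + (q x + (N * (N + 2) + 1)) * ‖y x‖ ^ 2) =
      U + (∫ x in (0 : ℝ)..1, q x * ‖y x‖ ^ 2) + (N * (N + 2) + 1) * Y := by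
    rw [← intervalIntegral.integral_const_mul, ← intervalIntegral.integral_add iu iq,
      ← intervalIntegral.integral_add (iu.add iq) (iy.const_mul _)]
    refine intervalIntegral.integral_congr fun x _ => ?_
    ring
  have hlow : -(N * ((N + 1) * Y + (U + (N + 1) ^ 2 * Y))) ≤
      (N + 1) * ∫ x in (0 : ℝ)..1, q x * ‖y x‖ ^ 2 := by
    have hl : -(N * ((N + 1) * Y + (U + (N + 1) ^ 2 * Y))) =
        ∫ x in (0 : ℝ)..1, -(|q x| * ((N + 1) * Y + (U + (N + 1) ^ 2 * Y))) := by
      rw [intervalIntegral.integral_neg, intervalIntegral.integral_mul_const]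
    have hr : (N + 1) * ∫ x in (0 : ℝ)..1, q x * ‖y x‖ ^ 2 =
        ∫ x in (0 : ℝ)..1, (N + 1) * (q x * ‖y x‖ ^ 2) :=
      (intervalIntegral.integral_const_mul _ _).symm
    rw [hl, hr]
    refine intervalIntegral.integral_mono_on zero_le_one (hq.norm.mul_const _).neg
      (iq.const_mul _) fun x hx => ?_
    have := hsup x hx
    have e4 : -|q x| ≤ q x := neg_abs_le _
    have e5 := abs_nonneg (q x)
    have e6 : 0 ≤ (N + 1) * ‖y x‖ ^ 2 := by positivity
    have h1 : -(|q x| * ((N + 1) * Y + (U + (N + 1) ^ 2 * Y))) ≤ -|q x| * ((N + 1) * ‖y x‖ ^ 2) := by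
      nlinarith
    have h2 : -|q x| * ((N + 1) * ‖y x‖ ^ 2) ≤ q x * ((N + 1) * ‖y x‖ ^ 2) :=
      mul_le_mul_of_nonneg_right e4 e6
    refine h1.trans (h2.trans (le_of_eq ?_))
    ring
  rw [hsplit]
  by_contra hcon
  push Not at hcon
  have : (N + 1) * (U + (∫ x in (0 : ℝ)..1, q x * ‖y x‖ ^ 2) + (N * (N + 2) + 1) * Y) <
    (N + 1) * Y := mul_lt_mul_of_pos_left hcon (by positivity)
  nlinarith

/-! ### Compactness and the resolvent. -/

/-- Arzelà–Ascoli: a common Lipschitz constant gives equicontinuity, and the Lipschitz condition is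
closed under pointwise limits within a product of closed balls. -/
theorem isCompact_lipschitz_ball (X : Type*) [MetricSpace X] (M : NNReal) :
    IsCompact {f : C(X, ℂ) | (∀ x, ‖f x‖ ≤ M) ∧ LipschitzWith M f} := by
  have himg : ContinuousMap.toFun '' {f : C(X, ℂ) | (∀ x, ‖f x‖ ≤ M) ∧ LipschitzWith M f} =
      (univ.pi fun _ : X => Metric.closedBall (0 : ℂ) M) ∩
        {f : X → ℂ | LipschitzWith M f} := by
    ext f
    constructor
    · rintro ⟨g, ⟨h1, h2⟩, rfl⟩
      exact ⟨fun x _ => by simpa using! h1 x, h2⟩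
    · rintro ⟨h1, h2⟩
      exact ⟨⟨f, h2.continuous⟩, ⟨fun x => by simpa using! h1 x (mem_univ x), h2⟩, rfl⟩
  refine ArzelaAscoli.isCompact_of_equicontinuous _ ?_ ?_
  · rw [himg]
    refine (isCompact_univ_pi fun _ => isCompact_closedBall (0 : ℂ) (M : ℝ)).inter_right ?_
    exact isClosed_setOfPred_lipschitzWith M
  · refine UniformEquicontinuous.equicontinuous (LipschitzWith.uniformEquicontinuous _ M fun f => ?_)
    exact f.2.2

theorem norm_expIntegral_le (c : ℝ) {h : ℝ → ℂ} (hh : IntervalIntegrable h volume 0 1) {x : ℝ}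
    (hx : x ∈ Icc (0 : ℝ) 1) :
    ‖expIntegral c h x‖ ≤ Real.exp |c| * ∫ s in (0 : ℝ)..1, ‖h s‖ := by
  have hi := (hh.norm.const_mul (Real.exp |c|))
  calc ‖expIntegral c h x‖ ≤ ∫ s in (0 : ℝ)..x, Real.exp |c| * ‖h s‖ := by
        refine intervalIntegral.norm_integral_le_of_norm_le hx.1
          (Filter.Eventually.of_forall fun s hs => ?_) (hi.mono_set ?_)
        · rw [norm_mul, Complex.norm_exp]
          gcongr
          have h1 : 0 ≤ s := hs.1.le
          have h2 : s ≤ 1 := hs.2.trans hx.2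
          simp only [Complex.mul_re, Complex.ofReal_re, Complex.ofReal_im, mul_zero, sub_zero]
          nlinarith [abs_nonneg c, le_abs_self c]
        · rw [uIcc_of_le hx.1, uIcc_of_le zero_le_one]
          exact Icc_subset_Icc_right hx.2
    _ ≤ ∫ s in (0 : ℝ)..1, Real.exp |c| * ‖h s‖ :=
        intervalIntegral.integral_mono_interval le_rfl hx.1 hx.2
          (Filter.Eventually.of_forall fun s => by positivity) hi
    _ = _ := intervalIntegral.integral_const_mul _ _

/-- One constant serves both signs: `σ = 1` bounds the values of `green` and `σ = -1` its Lipschitz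
constant, each by the `L¹` norm of `h`. This is the input for Arzelà–Ascoli. -/
theorem exists_norm_greenForm_le (t : ℝ) : ∃ K : ℝ, 0 ≤ K ∧ ∀ (σ : ℂ) (h : ℝ → ℂ), ‖σ‖ = 1 →
    IntervalIntegrable h volume 0 1 → ∀ x ∈ Icc (0 : ℝ) 1,
      ‖greenForm t σ (expIntegral (-1) h) (expIntegral 1 h) x‖ ≤
        K * ∫ s in (0 : ℝ)..1, ‖h s‖ := by
  set α := Complex.exp 1 / (Complex.exp 1 - Complex.exp (Complex.I * t)) with hα
  set β := 1 / (Complex.exp 1 * Complex.exp (Complex.I * t) - 1) with hβ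
  set e := Real.exp 1
  refine ⟨1 / 2 * (e * (‖α‖ * e + e) + (e + ‖β‖ * e)), by positivity,
    fun σ h hσ hh x hx => ?_⟩
  set N := ∫ s in (0 : ℝ)..1, ‖h s‖
  have hP : ∀ x ∈ Icc (0 : ℝ) 1, ‖expIntegral (-1) h x‖ ≤ e * N := fun x hx => by
    simpa using norm_expIntegral_le (-1) hh hx
  have hM : ∀ x ∈ Icc (0 : ℝ) 1, ‖expIntegral 1 h x‖ ≤ e * N := fun x hx => by
    simpa using norm_expIntegral_le 1 hh hx
  have h1 : (1 : ℝ) ∈ Icc (0 : ℝ) 1 := right_mem_Icc.2 zero_le_one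
  have hN : 0 ≤ e * N := (norm_nonneg _).trans (hP 1 h1)
  have e1 : ‖Complex.exp x‖ ≤ e := by
    rw [Complex.norm_exp]; exact Real.exp_le_exp.2 (by simpa using hx.2)
  have e2 : ‖Complex.exp (-x)‖ ≤ 1 := by
    rw [Complex.norm_exp]; exact Real.exp_le_one_iff.2 (by simpa using hx.1)
  have a1 : ‖α * expIntegral (-1) h 1 - expIntegral (-1) h x‖ ≤ ‖α‖ * (e * N) + e * N := by
    refine (norm_sub_le _ _).trans (add_le_add ?_ (hP x hx))
    rw [norm_mul]; gcongr; exact hP 1 h1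
  have a2 : ‖expIntegral 1 h x + β * expIntegral 1 h 1‖ ≤ e * N + ‖β‖ * (e * N) := by
    refine (norm_add_le _ _).trans (add_le_add (hM x hx) ?_)
    rw [norm_mul]; gcongr; exact hM 1 h1
  rw [greenForm, norm_mul]
  have b1 := norm_add_le (Complex.exp x * (α * expIntegral (-1) h 1 - expIntegral (-1) h x))
    (σ * (Complex.exp (-x) * (expIntegral 1 h x + β * expIntegral 1 h 1)))
  rw [norm_mul, norm_mul, norm_mul, hσ, one_mul] at b1
  have b2 := mul_le_mul e1 a1 (norm_nonneg _) (by positivity)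
  have b3 := mul_le_mul e2 a2 (norm_nonneg _) (by positivity)
  have b4 : ‖(1 / 2 : ℂ)‖ = 1 / 2 := by simp
  rw [b4]
  calc _ ≤ 1 / 2 * (e * (‖α‖ * (e * N) + e * N) + 1 * (e * N + ‖β‖ * (e * N))) := by
        gcongr
        exact b1.trans (add_le_add b2 b3)
    _ = _ := by ring

theorem expIntegral_congr (c : ℝ) {h h' : ℝ → ℂ}
    (hh : ∀ᵐ x ∂(volume.restrict (Icc (0 : ℝ) 1)), h x = h' x) {x : ℝ} (hx : x ∈ Icc (0 : ℝ) 1) :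
    expIntegral c h x = expIntegral c h' x := by
  refine intervalIntegral.integral_congr_ae ?_
  rw [ae_restrict_iff' measurableSet_Icc] at hh
  filter_upwards [hh] with s h1 h2
  rw [uIoc_of_le hx.1] at h2
  rw [h1 ⟨h2.1.le, h2.2.trans hx.2⟩]

theorem uIcc_zero_subset {x : ℝ} (hx : x ∈ Icc (0 : ℝ) 1) : uIcc 0 x ⊆ uIcc (0 : ℝ) 1 := by
  rw [uIcc_of_le hx.1, uIcc_of_le zero_le_one]
  exact Icc_subset_Icc_right hx.2

theorem expIntegral_add (c : ℝ) {h h' : ℝ → ℂ} (hh : IntervalIntegrable h volume 0 1)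
    (hh' : IntervalIntegrable h' volume 0 1) {x : ℝ} (hx : x ∈ Icc (0 : ℝ) 1) :
    expIntegral c (fun s => h s + h' s) x = expIntegral c h x + expIntegral c h' x := by
  rw [expIntegral, expIntegral, expIntegral, ← intervalIntegral.integral_add
    ((intervalIntegrable_exp_mul c hh).mono_set (uIcc_zero_subset hx))
    ((intervalIntegrable_exp_mul c hh').mono_set (uIcc_zero_subset hx))]
  simp only [mul_add]

theorem expIntegral_const_mul (c : ℝ) (a : ℂ) (h : ℝ → ℂ) (x : ℝ) :
    expIntegral c (fun s => a * h s) x = a * expIntegral c h x := by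
  rw [expIntegral, expIntegral, ← intervalIntegral.integral_const_mul]
  simp only [mul_left_comm]

theorem green_congr (t : ℝ) {h h' : ℝ → ℂ}
    (hh : ∀ᵐ x ∂(volume.restrict (Icc (0 : ℝ) 1)), h x = h' x) {x : ℝ} (hx : x ∈ Icc (0 : ℝ) 1) :
    green t h x = green t h' x := by
  have h1 : (1 : ℝ) ∈ Icc (0 : ℝ) 1 := right_mem_Icc.2 zero_le_one
  simp only [green, greenForm, expIntegral_congr _ hh hx, expIntegral_congr _ hh h1]

theorem green_add (t : ℝ) {h h' : ℝ → ℂ} (hh : IntervalIntegrable h volume 0 1)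
    (hh' : IntervalIntegrable h' volume 0 1) {x : ℝ} (hx : x ∈ Icc (0 : ℝ) 1) :
    green t (fun s => h s + h' s) x = green t h x + green t h' x := by
  have h1 : (1 : ℝ) ∈ Icc (0 : ℝ) 1 := right_mem_Icc.2 zero_le_one
  simp only [green, greenForm, expIntegral_add _ hh hh' hx, expIntegral_add _ hh hh' h1]
  ring

theorem green_const_mul (t : ℝ) (a : ℂ) (h : ℝ → ℂ) (x : ℝ) :
    green t (fun s => a * h s) x = a * green t h x := by
  simp only [green, greenForm, expIntegral_const_mul]
  ring

/-- Composing `green` with a bounded linear map into `L¹` gives a compact operator into the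
continuous functions. -/
theorem exists_compact_green (t : ℝ) {E : Type*} [NormedAddCommGroup E] [NormedSpace ℂ E]
    (J : E → ℝ → ℂ) (hJ : ∀ e, IntervalIntegrable (J e) volume 0 1)
    (hadd : ∀ e e', ∀ᵐ x ∂(volume.restrict (Icc (0 : ℝ) 1)), J (e + e') x = J e x + J e' x)
    (hsmul : ∀ (c : ℂ) e, ∀ᵐ x ∂(volume.restrict (Icc (0 : ℝ) 1)), J (c • e) x = c * J e x)
    {C : ℝ} (hC : ∀ e, ∫ s in (0 : ℝ)..1, ‖J e s‖ ≤ C * ‖e‖) :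
    ∃ K : E →L[ℂ] C(Icc (0 : ℝ) 1, ℂ), IsCompactOperator K ∧
      ∀ e (x : Icc (0 : ℝ) 1), K e x = green t (J e) x := by
  obtain ⟨B, hB0, hB⟩ := exists_norm_greenForm_le t
  have hsd := fun e => green_secondDeriv t (hJ e)
  let Φ : E →ₗ[ℂ] C(Icc (0 : ℝ) 1, ℂ) :=
    { toFun := fun e => ⟨fun x => green t (J e) x,
        continuousOn_iff_continuous_domRestrict.1 (hsd e).isC1.continuousOn⟩
      map_add' := fun e e' => by
        ext x
        change green t (J (e + e')) x = green t (J e) x + green t (J e') x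
        rw [green_congr t (hadd e e') x.2, green_add t (hJ e) (hJ e') x.2]
      map_smul' := fun c e => by
        ext x
        change green t (J (c • e)) x = c • green t (J e) x
        rw [green_congr t (hsmul c e) x.2, green_const_mul, smul_eq_mul] }
  have hΦ : IsCompactOperator Φ := by
    set M : NNReal := (B * |C|).toNNReal with hM
    have hM' : (M : ℝ) = B * |C| := Real.coe_toNNReal _ (by positivity)
    have hle : ∀ e ∈ Metric.closedBall (0 : E) 1, B * ∫ s in (0 : ℝ)..1, ‖J e s‖ ≤ M := by
      intro e he
      have he' : ‖e‖ ≤ 1 := by simpa using he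
      rw [hM']
      gcongr
      refine (hC e).trans ?_
      nlinarith [abs_nonneg C, le_abs_self C, norm_nonneg e]
    refine (isCompactOperator_iff_image_closedBall_subset_compact Φ zero_lt_one).2
      ⟨_, isCompact_lipschitz_ball (Icc (0 : ℝ) 1) M, ?_⟩
    rintro _ ⟨e, he, rfl⟩
    refine ⟨fun x => (hB 1 _ (by simp) (hJ e) x x.2).trans (hle e he), ?_⟩
    have hl : LipschitzOnWith M (green t (J e)) (Icc 0 1) := by
      refine (convex_Icc (0 : ℝ) 1).lipschitzOnWith_of_nnnorm_hasDerivWithin_le (hsd e).deriv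
        fun x hx => ?_
      rw [← NNReal.coe_le_coe]
      exact (hB (-1) _ (by simp) (hJ e) x hx).trans (hle e he)
    exact hl.to_restrict
  exact ⟨⟨Φ, hΦ.continuous⟩, hΦ, fun e x => rfl⟩

/-- The embedding of the continuous functions into `L²`. -/
theorem exists_continuous_to_L2 : ∃ ι : C(Icc (0 : ℝ) 1, ℂ) →L[ℂ] L2,
    ∀ f, ι f =ᵐ[volume.restrict (Icc (0 : ℝ) 1)] IccExtend (zero_le_one' ℝ) f := by
  have hm : ∀ f : C(Icc (0 : ℝ) 1, ℂ),
      MemLp (IccExtend (zero_le_one' ℝ) f) 2 (volume.restrict (Icc (0 : ℝ) 1)) := fun f =>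
    MemLp.of_bound f.continuous.Icc_extend'.aestronglyMeasurable ‖f‖
      (Filter.Eventually.of_forall fun x => f.norm_coe_le_norm _)
  refine ⟨LinearMap.mkContinuous
    { toFun := fun f => (hm f).toLp
      map_add' := fun f g => by exact (hm f).toLp_add (hm g)
      map_smul' := fun c f => by exact (hm f).toLp_const_smul c } 1 fun f => ?_,
      fun f => (hm f).coeFn_toLp⟩
  refine (Lp.norm_le_of_ae_bound (norm_nonneg f) ?_).trans (le_of_eq ?_)
  · filter_upwards [(hm f).coeFn_toLp] with x hx
    change ‖(hm f).toLp (IccExtend (zero_le_one' ℝ) f) x‖ ≤ ‖f‖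
    rw [hx]
    exact f.norm_coe_le_norm _
  · simp [measureUnivNNReal]

theorem intervalIntegrable_L2 (g : L2) : IntervalIntegrable g volume 0 1 :=
  intervalIntegrable_zero_one_iff.2 ((Lp.memLp g).integrable one_le_two)

theorem integral_norm_L2_le (g : L2) : ∫ s in (0 : ℝ)..1, ‖g s‖ ≤ 1 * ‖g‖ := by
  have h1 : ∫ s in (0 : ℝ)..1, ‖g s‖ = ∫ s in Icc (0 : ℝ) 1, ‖g s‖ := by
    rw [intervalIntegral.integral_of_le zero_le_one, integral_Icc_eq_integral_Ioc]
  have : IsProbabilityMeasure (volume.restrict (Icc (0 : ℝ) 1)) := ⟨by simp⟩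
  have h2 := eLpNorm_le_eLpNorm_of_exponent_le (μ := volume.restrict (Icc (0 : ℝ) 1))
    (f := g) one_le_two (Lp.aestronglyMeasurable g)
  rw [h1, one_mul, Lp.norm_def, integral_norm_eq_lintegral_enorm (Lp.aestronglyMeasurable g),
    ← eLpNorm_one_eq_lintegral_enorm]
  exact ENNReal.toReal_mono (Lp.eLpNorm_ne_top g) h2

theorem intervalIntegrable_ofReal {q : ℝ → ℝ} (hq : IntervalIntegrable q volume 0 1) :
    IntervalIntegrable (fun x => (q x : ℂ)) volume 0 1 :=
  ⟨Integrable.ofReal hq.1, Integrable.ofReal hq.2⟩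

/-- If the homogeneous problem has only the trivial solution, the inhomogeneous problem is solved
by a compact operator. -/
theorem exists_compact_resolvent {q : ℝ → ℝ} (hq : IntervalIntegrable q volume 0 1) (t : ℝ) (z : ℂ)
    (hz : ∀ y u : ℝ → ℂ, Solves t q y u (fun x => z * y x) → ∀ x ∈ Icc (0 : ℝ) 1, y x = 0) :
    ∃ R : L2 →L[ℂ] L2, IsCompactOperator R ∧ ∀ g : L2, ∃ y u : ℝ → ℂ,
      Solves t q y u (fun x => g x + z * y x) ∧
      R g =ᵐ[volume.restrict (Icc (0 : ℝ) 1)] y := by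
  have hI : uIcc (0 : ℝ) 1 = Icc 0 1 := uIcc_of_le zero_le_one
  -- The equation becomes `-y'' + y = g - p y`, that is `y + T y = S g` with `T` the Green operator
  -- after multiplication by `p`. Since `p` is merely integrable, `T` is set up on continuous
  -- functions, where `p y` stays integrable.
  set p : ℝ → ℂ := fun s => q s - 1 - z with hp
  have ip : IntervalIntegrable p volume 0 1 :=
    ((intervalIntegrable_ofReal hq).sub intervalIntegrable_const).sub intervalIntegrable_const
  have hext : ∀ f : C(Icc (0 : ℝ) 1, ℂ), Continuous (IccExtend (zero_le_one' ℝ) f) :=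
    fun f => f.continuous.Icc_extend'
  have ij : ∀ f : C(Icc (0 : ℝ) 1, ℂ),
      IntervalIntegrable (fun s => p s * IccExtend (zero_le_one' ℝ) f s) volume 0 1 :=
    fun f => ip.mul_continuousOn (hext f).continuousOn
  obtain ⟨T, hTc, hT⟩ := exists_compact_green t
    (J := fun (f : C(Icc (0 : ℝ) 1, ℂ)) s => p s * IccExtend (zero_le_one' ℝ) f s) ij
    (fun e e' => Filter.Eventually.of_forall fun x => mul_add _ _ _)
    (fun c e => Filter.Eventually.of_forall fun x => mul_left_comm _ _ _)
    (C := ∫ s in (0 : ℝ)..1, ‖p s‖) (fun e => by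
      rw [← intervalIntegral.integral_mul_const]
      refine intervalIntegral.integral_mono_on zero_le_one (ij e).norm (ip.norm.mul_const _)
        fun x _ => ?_
      rw [norm_mul]
      gcongr
      exact e.norm_coe_le_norm _)
  obtain ⟨S, hSc, hS⟩ := exists_compact_green t (J := fun (g : L2) s => g s)
    intervalIntegrable_L2 (fun e e' => Lp.coeFn_add e e') (fun c e => Lp.coeFn_smul c e)
    integral_norm_L2_le
  obtain ⟨ι, hι⟩ := exists_continuous_to_L2
  have key : ∀ (y : C(Icc (0 : ℝ) 1, ℂ)) (g : L2), y + T y = S g → ∃ Y U : ℝ → ℂ,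
      Solves t q Y U (fun x => g x + z * Y x) ∧ ∀ x : Icc (0 : ℝ) 1, Y x = y x := by
    intro y g hyg
    have hh : IntervalIntegrable (fun s => g s + -1 * (p s * IccExtend (zero_le_one' ℝ) y s))
      volume 0 1 := (intervalIntegrable_L2 g).add ((ij y).const_mul _)
    have hY : ∀ x : Icc (0 : ℝ) 1,
        green t (fun s => g s + -1 * (p s * IccExtend (zero_le_one' ℝ) y s)) x = y x := by
      intro x
      rw [green_add t (intervalIntegrable_L2 g) ((ij y).const_mul _) x.2, green_const_mul,
        ← hS, ← hT, ← hyg, ContinuousMap.add_apply]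
      ring
    refine ⟨_, _, solves_iff.2 ((green_secondDeriv t hh).congr_ae ?_), hY⟩
    filter_upwards [ae_restrict_mem measurableSet_Icc] with x hx
    have h1 := hY ⟨x, hx⟩
    simp only at h1
    rw [IccExtend_of_mem _ _ hx, h1, hp]
    ring
  -- Fredholm alternative: an eigenvector of `T` for `-1` would solve the homogeneous problem, which
  -- `hz` excludes.
  have hA : (-1 : ℂ) ∈ _root_.resolventSet ℂ T := by
    refine (hTc.hasEigenvalue_or_mem_resolventSet (by simp)).resolve_left fun hev => ?_
    obtain ⟨y, hy⟩ := hev.exists_hasEigenvector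
    have hy1 : T y = -y := hy.apply_eq_smul.trans (by ext x; simp)
    obtain ⟨Y, U, h1, h2⟩ := key y 0 (by rw [hy1, add_neg_cancel, map_zero])
    have h3 : Solves t q Y U (fun x => z * Y x) := by
      refine solves_iff.2 ((solves_iff.1 h1).congr_ae ?_)
      filter_upwards [Lp.coeFn_zero ℂ 2 (volume.restrict (Icc (0 : ℝ) 1))] with x hx
      rw [hx]; simp
    refine hy.2 (ContinuousMap.ext fun x => ?_)
    rw [← h2 x, hz Y U h3 x x.2]; rfl
  rw [spectrum.mem_resolventSet_iff] at hA
  obtain ⟨A, hA⟩ := hA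
  -- Here `A = -1 - T`, so `-A⁻¹` inverts `1 + T`.
  refine ⟨ι ∘L (-(↑A⁻¹ : C(Icc (0 : ℝ) 1, ℂ) →L[ℂ] C(Icc (0 : ℝ) 1, ℂ)) ∘L S), ?_, fun g => ?_⟩
  · exact (hSc.clm_comp (-(↑A⁻¹ : C(Icc (0 : ℝ) 1, ℂ) →L[ℂ] C(Icc (0 : ℝ) 1, ℂ)))).clm_comp ι
  · set y := (-(↑A⁻¹ : C(Icc (0 : ℝ) 1, ℂ) →L[ℂ] C(Icc (0 : ℝ) 1, ℂ))) (S g) with hy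
    have h1 : y + T y = S g := by
      have h2 : (A : C(Icc (0 : ℝ) 1, ℂ) →L[ℂ] C(Icc (0 : ℝ) 1, ℂ)) y = - S g := by
        rw [hy, _root_.neg_apply, map_neg, ← mul_apply_eq_comp,
          Units.mul_inv, one_apply_eq_self]
      rw [hA] at h2
      simp only [map_neg, map_one, _root_.sub_apply, _root_.neg_apply,
        one_apply_eq_self] at h2
      rw [← neg_eq_iff_eq_neg] at h2
      rw [← h2]; abel
    obtain ⟨Y, U, h3, h4⟩ := key y g h1
    refine ⟨Y, U, h3, ?_⟩
    filter_upwards [hι y, ae_restrict_mem measurableSet_Icc] with x h5 hx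
    change ι y x = Y x
    rw [h5, IccExtend_of_mem _ _ hx, ← h4 ⟨x, hx⟩]

/-! ### From the operator to the differential equation. -/

theorem mem_graph_iff {t : ℝ} {q : ℝ → ℝ} {f g : L2} :
    (f, g) ∈ graph t q ↔ ∃ y u : ℝ → ℂ, Solves t q y u g ∧
      f =ᵐ[volume.restrict (Icc (0 : ℝ) 1)] y := Iff.rfl

theorem L_apply_iff {t : ℝ} {q : ℝ → ℝ} {f g : L2} :
    (∃ h : f ∈ (L t q).domain, L t q ⟨f, h⟩ = g) ↔ ∃ y u : ℝ → ℂ, Solves t q y u g ∧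
      f =ᵐ[volume.restrict (Icc (0 : ℝ) 1)] y := by
  rw [← mem_graph_iff, ← L_graph, LinearPMap.mem_graph_iff]
  constructor
  · rintro ⟨h, e⟩
    exact ⟨⟨f, h⟩, rfl, e⟩
  · rintro ⟨⟨f', h⟩, rfl, e⟩
    exact ⟨h, e⟩

theorem Solves.congr_ae {t : ℝ} {q : ℝ → ℝ} {y u g g' : ℝ → ℂ} (h : Solves t q y u g)
    (hg : ∀ᵐ x ∂(volume.restrict (Icc (0 : ℝ) 1)), g x = g' x) : Solves t q y u g' := by
  refine solves_iff.2 ((solves_iff.1 h).congr_ae ?_)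
  filter_upwards [hg] with x hx
  rw [hx]

theorem Solves.sub {t : ℝ} {q : ℝ → ℝ} {y u g y' u' g' : ℝ → ℂ} (h : Solves t q y u g)
    (h' : Solves t q y' u' g') :
    Solves t q (fun x => y x - y' x) (fun x => u x - u' x) (fun x => g x - g' x) := by
  refine solves_iff.2 (((solves_iff.1 h).sub (solves_iff.1 h')).congr_ae
    (Filter.Eventually.of_forall fun x => ?_))
  ring

/-- By contraposition: without a nontrivial solution the operator of `exists_compact_resolvent` is a
bounded two-sided inverse of `L t q - z`. -/
theorem exists_solution_of_mem_spectrum {q : ℝ → ℝ} (hq : IntervalIntegrable q volume 0 1) {t : ℝ}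
    {z : ℂ} (hz : z ∈ spectrum (L t q)) :
    ∃ y u : ℝ → ℂ, Solves t q y u (fun x => z * y x) ∧ ∃ x ∈ Icc (0 : ℝ) 1, y x ≠ 0 := by
  by_contra! hcon
  obtain ⟨R, -, hR⟩ := exists_compact_resolvent hq t z hcon
  refine hz ⟨R, fun h => ?_, fun f => ?_⟩
  · obtain ⟨y, u, h1, h2⟩ := hR h
    have h3 : Solves t q y u (h + z • R h : L2) := h1.congr_ae (by
      filter_upwards [Lp.coeFn_add h (z • R h), Lp.coeFn_smul z (R h), h2] with x e1 e2 e3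
      rw [e1, Pi.add_apply, e2, Pi.smul_apply, e3, smul_eq_mul])
    obtain ⟨hd, e⟩ := L_apply_iff.2 ⟨y, u, h3, h2⟩
    exact ⟨⟨R h, hd⟩, rfl, by rw [e]; simp⟩
  · obtain ⟨y, u, h1, h2⟩ := L_apply_iff.1 ⟨f.2, rfl⟩
    obtain ⟨y', u', h1', h2'⟩ := hR (L t q f - z • (f : L2))
    have h3 := h1'.sub h1
    have h4 := hcon _ _ (h3.congr_ae (g' := fun x => z * (y' x - y x)) (by
      filter_upwards [Lp.coeFn_sub (L t q f) (z • (f : L2)), Lp.coeFn_smul z (f : L2), h2] with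
        x e1 e2 e3
      rw [e1, Pi.sub_apply, e2, Pi.smul_apply, e3, smul_eq_mul]
      ring))
    refine Lp.ext ?_
    filter_upwards [h2, h2', ae_restrict_mem measurableSet_Icc] with x e1 e2 hx
    rw [e2, e1]
    exact sub_eq_zero.1 (h4 x hx)

/-! ### High eigenvalues and the mean of `q`. -/

open Filter Topology

/-- The Fourier integral of `q` over `[0,1]`. -/
def fourierCoeff (q : ℝ → ℝ) (k : ℝ) : ℂ := ∫ x in (0 : ℝ)..1, Complex.exp (Complex.I * k * x) * q x

theorem fourierCoeff_zero (q : ℝ → ℝ) : fourierCoeff q 0 = ((∫ x in (0 : ℝ)..1, q x : ℝ) : ℂ) := by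
  simp [fourierCoeff, intervalIntegral.integral_ofReal]

/-- The Riemann–Lebesgue lemma for `q` extended by zero; the factor `-(2π)⁻¹` converts to the kernel
`e^{-2πivw}`. -/
theorem tendsto_fourierCoeff (q : ℝ → ℝ) : Tendsto (fourierCoeff q) (cocompact ℝ) (𝓝 0) := by
  have h := Real.tendsto_integral_exp_smul_cocompact
    ((Ioc (0 : ℝ) 1).indicator fun x => (q x : ℂ))
  have hm : Tendsto (fun k : ℝ => k * (-(2 * Real.pi)⁻¹)) (cocompact ℝ) (cocompact ℝ) :=
    tendsto_cocompact_mul_right₀ (by simp [Real.pi_ne_zero])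
  refine (h.comp hm).congr fun k => ?_
  rw [fourierCoeff, intervalIntegral.integral_of_le zero_le_one,
    ← integral_indicator measurableSet_Ioc]
  refine integral_congr_ae (Eventually.of_forall fun v => ?_)
  by_cases hv : v ∈ Ioc (0 : ℝ) 1
  · simp only [indicator_of_mem hv, Circle.smul_def, Real.fourierChar_apply, smul_eq_mul]
    congr 2
    push_cast
    have : (Real.pi : ℂ) ≠ 0 := by exact_mod_cast Real.pi_ne_zero
    field_simp
  · simp [indicator_of_notMem hv]

theorem norm_exp_I_mul_mul (k x : ℝ) : ‖Complex.exp (Complex.I * k * x)‖ = 1 := by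
  have : Complex.I * k * x = ((k * x : ℝ) : ℂ) * Complex.I := by push_cast; ring
  rw [this, Complex.norm_exp_ofReal_mul_I]

/-- Variation of constants for one of the two exponentials. -/
theorem exp_mul_deriv_eq {q : ℝ → ℝ} (hq : IntervalIntegrable q volume 0 1) {t k : ℝ} {y u : ℝ → ℂ}
    (h : Solves t q y u (fun x => (k : ℂ) ^ 2 * y x)) :
    ∀ x ∈ Icc (0 : ℝ) 1, Complex.exp (Complex.I * k * x) * (u x - Complex.I * k * y x) =
      (u 0 - Complex.I * k * y 0) +
        ∫ s in (0 : ℝ)..x, Complex.exp (Complex.I * k * s) * (q s * y s) := by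
  have h' := solves_iff.1 h
  have hI : uIcc (0 : ℝ) 1 = Icc 0 1 := uIcc_of_le zero_le_one
  have hi : IntervalIntegrable (fun s : ℝ => Complex.exp (Complex.I * k * s) * (q s * y s))
      volume 0 1 := ((intervalIntegrable_ofReal hq).mul_continuousOn
        (by rw [hI]; exact h'.isC1.continuousOn)).continuousOn_mul (by fun_prop)
  have := eq_add_integral_of_ac
    (f := fun x => Complex.exp (Complex.I * k * x) * (u x - Complex.I * k * y x))
    ((ac_exp _).fun_smul (h'.ac.fun_sub (ac_const_mul _ h'.isC1.ac))) hi (by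
      filter_upwards [h'.ae, h'.isC1.ae_hasDerivAt] with x h1 h2
      refine ((hasDerivAt_exp_mul (Complex.I * k) x).mul
        (h1.fun_sub (h2.const_mul (Complex.I * k)))).congr_deriv ?_
      linear_combination (-Complex.exp (Complex.I * k * x) * k ^ 2 * y x) * Complex.I_sq)
  simpa using this

theorem norm_integral_mul_le {q : ℝ → ℝ} (hq : IntervalIntegrable q volume 0 1) {f : ℝ → ℂ} {C : ℝ}
    (hf : ∀ x ∈ Icc (0 : ℝ) 1, ‖f x‖ ≤ C) {x : ℝ} (hx : x ∈ Icc (0 : ℝ) 1) :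
    ‖∫ s in (0 : ℝ)..x, f s * q s‖ ≤ C * ∫ s in (0 : ℝ)..1, |q s| := by
  have hC : 0 ≤ C := (norm_nonneg _).trans (hf x hx)
  rw [← intervalIntegral.integral_const_mul]
  have hi : IntervalIntegrable (fun s => C * |q s|) volume 0 1 := hq.norm.const_mul C
  refine (intervalIntegral.norm_integral_le_of_norm_le hx.1 (g := fun s => C * |q s|)
    (Eventually.of_forall fun s hs => ?_) (hi.mono_set (uIcc_zero_subset hx))).trans ?_
  · rw [norm_mul, Complex.norm_real, Real.norm_eq_abs]
    gcongr
    exact hf s ⟨hs.1.le, hs.2.trans hx.2⟩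
  · exact intervalIntegral.integral_mono_interval le_rfl hx.1 hx.2
      (Eventually.of_forall fun s => by positivity) hi

/-- Replacing `y` by `a e^{ikx} + b e^{-ikx}` in the vanishing integral produces exactly the two
Fourier coefficients, with an error of at most `C` times the `L¹` norm of `q`. -/
theorem integral_exp_mul_sub_le {q : ℝ → ℝ} (hq : IntervalIntegrable q volume 0 1) {k C : ℝ}
    {y : ℝ → ℂ} (hy : ContinuousOn y (Icc (0 : ℝ) 1)) {a b : ℂ}
    (hC : ∀ x ∈ Icc (0 : ℝ) 1, ‖y x - (a * Complex.exp (Complex.I * k * x) +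
      b * Complex.exp (Complex.I * (-k : ℝ) * x))‖ ≤ C)
    (h0 : ∫ s in (0 : ℝ)..1, Complex.exp (Complex.I * k * s) * (q s * y s) = 0) :
    ‖b * fourierCoeff q 0 + a * fourierCoeff q (2 * k)‖ ≤ C * ∫ s in (0 : ℝ)..1, |q s| := by
  have hI : uIcc (0 : ℝ) 1 = Icc 0 1 := uIcc_of_le zero_le_one
  have iq := intervalIntegrable_ofReal hq
  have i1 : IntervalIntegrable (fun s : ℝ => Complex.exp (Complex.I * k * s) * (q s * y s))
      volume 0 1 := (iq.mul_continuousOn (by rwa [hI])).continuousOn_mul (by fun_prop)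
  have i2 : ∀ l : ℝ, IntervalIntegrable (fun s : ℝ => Complex.exp (Complex.I * l * s) * q s)
      volume 0 1 := fun l => iq.continuousOn_mul (by fun_prop)
  have e : b * fourierCoeff q 0 + a * fourierCoeff q (2 * k) =
      - ∫ s in (0 : ℝ)..1, (Complex.exp (Complex.I * k * s) * (y s -
        (a * Complex.exp (Complex.I * k * s) + b * Complex.exp (Complex.I * (-k : ℝ) * s)))) *
          q s := by
    have e1 : (∫ s in (0 : ℝ)..1, (Complex.exp (Complex.I * k * s) * (y s -
        (a * Complex.exp (Complex.I * k * s) + b * Complex.exp (Complex.I * (-k : ℝ) * s)))) *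
          q s) = ∫ s in (0 : ℝ)..1, (Complex.exp (Complex.I * k * s) * (q s * y s) -
            (b * (Complex.exp (Complex.I * (0 : ℝ) * s) * q s) +
              a * (Complex.exp (Complex.I * (2 * k : ℝ) * s) * q s))) := by
      refine intervalIntegral.integral_congr fun s _ => ?_
      have e2 : Complex.exp (Complex.I * (2 * k : ℝ) * s) =
          Complex.exp (Complex.I * k * s) * Complex.exp (Complex.I * k * s) := by
        rw [← Complex.exp_add]; push_cast; ring_nf
      have e3 : Complex.exp (Complex.I * (0 : ℝ) * s) =
          Complex.exp (Complex.I * k * s) * Complex.exp (Complex.I * (-k : ℝ) * s) := by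
        rw [← Complex.exp_add]; push_cast; ring_nf
      simp only [e2, e3]
      ring
    rw [e1, intervalIntegral.integral_sub i1 (((i2 0).const_mul b).add ((i2 (2 * k)).const_mul a)),
      h0, intervalIntegral.integral_add ((i2 0).const_mul b) ((i2 (2 * k)).const_mul a),
      intervalIntegral.integral_const_mul, intervalIntegral.integral_const_mul, fourierCoeff,
      fourierCoeff]
    ring
  rw [e, norm_neg]
  refine norm_integral_mul_le hq (fun x hx => ?_) (right_mem_Icc.2 zero_le_one)
  rw [norm_mul, norm_exp_I_mul_mul, one_mul]
  exact hC x hx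

/-- The leading coefficients of a normalized eigenfunction with eigenvalue `k²`, where
`e^{ik} = e^{-it}`. -/
theorem exists_coeff_of_solves {q : ℝ → ℝ} (hq : IntervalIntegrable q volume 0 1) {t k : ℝ}
    (hk : 0 < k) (hkt : Complex.exp (Complex.I * k) * Complex.exp (Complex.I * t) = 1)
    {y u : ℝ → ℂ} (h : Solves t q y u (fun x => (k : ℂ) ^ 2 * y x))
    (h0 : ∃ x ∈ Icc (0 : ℝ) 1, y x ≠ 0) :
    ∃ a b : ℂ, 1 ≤ ‖a‖ + ‖b‖ + (∫ s in (0 : ℝ)..1, |q s|) / k ∧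
      ‖b * fourierCoeff q 0 + a * fourierCoeff q (2 * k)‖ ≤
        (∫ s in (0 : ℝ)..1, |q s|) / k * ∫ s in (0 : ℝ)..1, |q s| ∧
      ‖Complex.exp (Complex.I * t) ^ 2 - 1‖ * ‖a‖ ≤ (∫ s in (0 : ℝ)..1, |q s|) / (2 * k) ∧
      (Complex.exp (Complex.I * t) ^ 2 = 1 →
        ‖a * fourierCoeff q 0 + b * fourierCoeff q (2 * -k)‖ ≤
          (∫ s in (0 : ℝ)..1, |q s|) / k * ∫ s in (0 : ℝ)..1, |q s|) := by
  set N := ∫ s in (0 : ℝ)..1, |q s| with hN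
  set E := Complex.exp (Complex.I * t) with hE
  have h1I : (1 : ℝ) ∈ Icc (0 : ℝ) 1 := right_mem_Icc.2 zero_le_one
  -- normalize
  obtain ⟨y, u, h, x₀, hx₀, hy₀, hmax⟩ : ∃ y u : ℝ → ℂ,
      Solves t q y u (fun x => (k : ℂ) ^ 2 * y x) ∧ ∃ x₀ ∈ Icc (0 : ℝ) 1, ‖y x₀‖ = 1 ∧
        ∀ x ∈ Icc (0 : ℝ) 1, ‖y x‖ ≤ 1 := by
    have h' := solves_iff.1 h
    obtain ⟨x₀, hx₀, hm⟩ := isCompact_Icc.exists_isMaxOn ⟨1, h1I⟩ h'.isC1.continuousOn.norm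
    obtain ⟨x₁, hx₁, hne⟩ := h0
    have hpos : 0 < ‖y x₀‖ := (norm_pos_iff.2 hne).trans_le (hm hx₁)
    refine ⟨fun x => (‖y x₀‖ : ℂ)⁻¹ * y x, fun x => (‖y x₀‖ : ℂ)⁻¹ * u x,
      solves_iff.2 ((h'.const_mul _).congr_ae (Eventually.of_forall fun x => by ring)),
      x₀, hx₀, ?_, fun x hx => ?_⟩
    · rw [norm_mul, norm_inv, Complex.norm_real, norm_norm, inv_mul_cancel₀ hpos.ne']
    · rw [norm_mul, norm_inv, Complex.norm_real, norm_norm, inv_mul_le_iff₀ hpos, mul_one]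
      exact hm hx
  have h' := solves_iff.1 h
  -- Only `k²` enters the equation, so variation of constants also applies with `-k`. The two
  -- relations determine the coefficients of both exponentials.
  have hm : Solves t q y u (fun x => ((-k : ℝ) : ℂ) ^ 2 * y x) := by
    refine h.congr_ae (Eventually.of_forall fun x => ?_)
    push_cast; ring
  have hB := exp_mul_deriv_eq hq h
  have hA := exp_mul_deriv_eq hq hm
  have hbd : ∀ l : ℝ, ∀ x ∈ Icc (0 : ℝ) 1,
      ‖∫ s in (0 : ℝ)..x, Complex.exp (Complex.I * l * s) * (q s * y s)‖ ≤ N := by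
    intro l x hx
    have := norm_integral_mul_le hq (f := fun s => Complex.exp (Complex.I * l * s) * y s) (C := 1)
      (fun s hs => by rw [norm_mul, norm_exp_I_mul_mul, one_mul]; exact hmax s hs) hx
    rw [one_mul] at this
    convert this using 4
    ring
  have hkC : (k : ℂ) ≠ 0 := by exact_mod_cast hk.ne'
  have h2k : (2 * Complex.I * k : ℂ) ≠ 0 := by simp [hkC]
  have n2k : ‖(2 * Complex.I * k : ℂ)‖ = 2 * k := by
    rw [norm_mul, norm_mul, Complex.norm_real, Real.norm_eq_abs, abs_of_pos hk]; simp
  set A₀ := u 0 - Complex.I * (-k : ℝ) * y 0 with hA₀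
  set B₀ := u 0 - Complex.I * k * y 0 with hB₀
  have hexp : ∀ x : ℝ, Complex.exp (Complex.I * k * x) * Complex.exp (Complex.I * (-k : ℝ) * x) = 1 := by
    intro x
    rw [← Complex.exp_add, ← Complex.exp_zero]
    push_cast; ring_nf
  have hC : ∀ x ∈ Icc (0 : ℝ) 1, ‖y x - (A₀ / (2 * Complex.I * k) * Complex.exp (Complex.I * k * x) +
      -B₀ / (2 * Complex.I * k) * Complex.exp (Complex.I * (-k : ℝ) * x))‖ ≤ N / k := by
    intro x hx
    have e : (2 * Complex.I * k) * (y x - (A₀ / (2 * Complex.I * k) * Complex.exp (Complex.I * k * x) +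
        -B₀ / (2 * Complex.I * k) * Complex.exp (Complex.I * (-k : ℝ) * x))) =
        Complex.exp (Complex.I * k * x) *
          (∫ s in (0 : ℝ)..x, Complex.exp (Complex.I * (-k : ℝ) * s) * (q s * y s)) -
        Complex.exp (Complex.I * (-k : ℝ) * x) *
          (∫ s in (0 : ℝ)..x, Complex.exp (Complex.I * k * s) * (q s * y s)) := by
      have e1 := hA x hx
      have e2 := hB x hx
      have e3 := hexp x
      have e4 : (2 * Complex.I * k) * (A₀ / (2 * Complex.I * k)) = A₀ := mul_div_cancel₀ _ h2k
      have e5 : (2 * Complex.I * k) * (-B₀ / (2 * Complex.I * k)) = -B₀ := mul_div_cancel₀ _ h2k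
      have e6 : ((-k : ℝ) : ℂ) = -k := by push_cast; ring
      rw [mul_sub, mul_add, ← mul_assoc _ (A₀ / _), ← mul_assoc _ (-B₀ / _), e4, e5]
      have e7 : Complex.I * ((-k : ℝ) : ℂ) * y x = - (Complex.I * k * y x) := by rw [e6]; ring
      rw [e7] at e1
      linear_combination Complex.exp (Complex.I * k * x) * e1 -
        Complex.exp (Complex.I * (-k : ℝ) * x) * e2 + (-2 * Complex.I * k * y x) * e3
    have e8 := congrArg norm e
    rw [norm_mul, n2k] at e8
    have e9 := norm_sub_le (Complex.exp (Complex.I * k * x) *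
          (∫ s in (0 : ℝ)..x, Complex.exp (Complex.I * (-k : ℝ) * s) * (q s * y s)))
        (Complex.exp (Complex.I * (-k : ℝ) * x) *
          (∫ s in (0 : ℝ)..x, Complex.exp (Complex.I * k * s) * (q s * y s)))
    rw [norm_mul, norm_mul, norm_exp_I_mul_mul, norm_exp_I_mul_mul, one_mul, one_mul, ← e8] at e9
    have e10 := hbd (-k) x hx
    have e11 := hbd k x hx
    rw [le_div_iff₀ hk]
    linarith
  -- Since `e^{ik} e^{it} = 1`, the boundary values at `0` and `1` cancel.
  have hB1 : ∫ s in (0 : ℝ)..1, Complex.exp (Complex.I * k * s) * (q s * y s) = 0 := by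
    have := hB 1 h1I
    rw [h'.bc, h'.bc', Complex.ofReal_one, mul_one, ← hE] at this
    linear_combination -this + B₀ * hkt
  -- With `-k` the boundary factor is `E²`, because `e^{-ik} = E`. Either `E² = 1` and this integral
  -- vanishes as well, or the bound `N` on the integral makes `a = A₀ / (2ik)` of order `1/k`.
  have hA1 : ∫ s in (0 : ℝ)..1, Complex.exp (Complex.I * (-k : ℝ) * s) * (q s * y s) =
      (E ^ 2 - 1) * A₀ := by
    have h1 := hA 1 h1I
    have h2 := hexp 1
    rw [h'.bc, h'.bc', Complex.ofReal_one, mul_one, ← hE] at h1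
    rw [Complex.ofReal_one, mul_one, mul_one] at h2
    have h3 : Complex.exp (Complex.I * (-k : ℝ)) = E := by
      linear_combination (-Complex.exp (Complex.I * (-k : ℝ))) * hkt + E * h2
    rw [h3] at h1
    linear_combination -h1
  refine ⟨A₀ / (2 * Complex.I * k), -B₀ / (2 * Complex.I * k), ?_, ?_, ?_, ?_⟩
  · have h1 := hC x₀ hx₀
    have h2 := norm_add_le (A₀ / (2 * Complex.I * k) * Complex.exp (Complex.I * k * x₀))
      (-B₀ / (2 * Complex.I * k) * Complex.exp (Complex.I * (-k : ℝ) * x₀))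
    rw [norm_mul, norm_mul, norm_exp_I_mul_mul, norm_exp_I_mul_mul, mul_one, mul_one] at h2
    have h3 := norm_sub_norm_le (y x₀) (A₀ / (2 * Complex.I * k) * Complex.exp (Complex.I * k * x₀) +
      -B₀ / (2 * Complex.I * k) * Complex.exp (Complex.I * (-k : ℝ) * x₀))
    rw [hy₀] at h3
    linarith
  · exact integral_exp_mul_sub_le hq h'.isC1.continuousOn hC hB1
  · have h1 := hbd (-k) 1 h1I
    rw [hA1, norm_mul] at h1
    rw [norm_div, n2k, ← mul_div_assoc]
    gcongr
  · intro hE2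
    rw [hE2, sub_self, zero_mul] at hA1
    refine integral_exp_mul_sub_le hq h'.isC1.continuousOn (fun x hx => ?_) hA1
    rw [neg_neg, add_comm]
    exact hC x hx

theorem exp_I_mul_eq (t : ℝ) (n : ℕ) : Complex.exp (Complex.I * (2 * n * Real.pi - t : ℝ)) *
    Complex.exp (Complex.I * t) = 1 := by
  rw [← Complex.exp_add, Complex.exp_eq_one_iff]
  exact ⟨n, by push_cast; ring⟩

/-- If the points `(2nπ-t)²` belong to the spectrum, then `q` has mean zero. -/
theorem integral_eq_zero_of_spectrum {q : ℝ → ℝ} (hq : IntervalIntegrable q volume 0 1) (t : ℝ)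
    (hspec : ∀ n : ℕ, 1 ≤ n →
      (((2 * n * Real.pi - t) ^ 2 : ℝ) : ℂ) ∈ spectrum (L t q)) :
    ∫ x in (0 : ℝ)..1, q x = 0 := by
  set N := ∫ s in (0 : ℝ)..1, |q s| with hN
  have hN0 : 0 ≤ N := intervalIntegral.integral_nonneg zero_le_one fun x _ => abs_nonneg _
  set Q := ‖fourierCoeff q 0‖ with hQ
  suffices hQ0 : Q ≤ 0 by
    have h1 := norm_le_zero_iff.1 hQ0
    rw [fourierCoeff_zero] at h1
    exact_mod_cast h1
  set k : ℕ → ℝ := fun n => 2 * n * Real.pi - t with hk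
  have hkt : Tendsto k atTop atTop := by
    refine tendsto_atTop_add_const_right _ (-t) ?_
    exact (tendsto_natCast_atTop_atTop.const_mul_atTop two_pos).atTop_mul_const Real.pi_pos
  have hki : Tendsto (fun n => (k n)⁻¹) atTop (𝓝 0) := tendsto_inv_atTop_zero.comp hkt
  have hcoef : ∀ᶠ n in atTop, 0 < k n ∧ ∃ a b : ℂ, 1 ≤ ‖a‖ + ‖b‖ + N / k n ∧
      ‖b * fourierCoeff q 0 + a * fourierCoeff q (2 * k n)‖ ≤ N / k n * N ∧
      ‖Complex.exp (Complex.I * t) ^ 2 - 1‖ * ‖a‖ ≤ N / (2 * k n) ∧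
      (Complex.exp (Complex.I * t) ^ 2 = 1 →
        ‖a * fourierCoeff q 0 + b * fourierCoeff q (2 * -k n)‖ ≤ N / k n * N) := by
    filter_upwards [eventually_ge_atTop 1, hkt.eventually_gt_atTop 0] with n hn hpos
    obtain ⟨y, u, h1, h2⟩ := exists_solution_of_mem_spectrum hq (hspec n hn)
    refine ⟨hpos, exists_coeff_of_solves hq hpos (exp_I_mul_eq t n)
      (h1.congr_ae (Eventually.of_forall fun x => ?_)) h2⟩
    simp [hk]
  -- The periodic and antiperiodic cases, where neither coefficient need be small, are separated
  -- from all others.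
  by_cases hE : Complex.exp (Complex.I * t) ^ 2 = 1
  · have l1 : Tendsto (fun n => ‖fourierCoeff q (2 * k n)‖) atTop (𝓝 0) := by
      have : Tendsto (fun n => 2 * k n) atTop (cocompact ℝ) :=
        (hkt.const_mul_atTop two_pos).mono_right atTop_le_cocompact
      simpa using ((tendsto_fourierCoeff q).comp this).norm
    have l2 : Tendsto (fun n => ‖fourierCoeff q (2 * -k n)‖) atTop (𝓝 0) := by
      have : Tendsto (fun n => 2 * -k n) atTop (cocompact ℝ) :=
        ((tendsto_neg_atTop_atBot.comp hkt).const_mul_atBot two_pos).mono_right atBot_le_cocompact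
      simpa using ((tendsto_fourierCoeff q).comp this).norm
    have l3 : Tendsto (fun n => ‖fourierCoeff q (2 * k n)‖ + ‖fourierCoeff q (2 * -k n)‖ +
        4 * N ^ 2 * (k n)⁻¹) atTop (𝓝 0) := by
      simpa using (l1.add l2).add (hki.const_mul (4 * N ^ 2))
    refine ge_of_tendsto l3 ?_
    filter_upwards [hcoef, hkt.eventually_ge_atTop (2 * N)] with n hn hn2
    obtain ⟨hpos, a, b, h1, h2, -, h4⟩ := hn
    have hNk : N / k n ≤ 1 / 2 := by
      rw [div_le_iff₀ hpos]; linarith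
    -- The larger coefficient has modulus at least `1/4`, because `N / k n ≤ 1/2`; dividing by it
    -- yields the factor `4`.
    have gen : ∀ a b f : ℂ, ‖a‖ ≤ ‖b‖ → 1 ≤ ‖a‖ + ‖b‖ + N / k n →
        ‖b * fourierCoeff q 0 + a * f‖ ≤ N / k n * N → Q ≤ ‖f‖ + 4 * N ^ 2 * (k n)⁻¹ := by
      intro a b f hab h1 h2
      have hb : 1 / 4 ≤ ‖b‖ := by linarith
      have h3 : ‖b‖ * Q ≤ N / k n * N + ‖b‖ * ‖f‖ := by
        have h5 := norm_sub_le (b * fourierCoeff q 0 + a * f) (a * f)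
        rw [add_sub_cancel_right, norm_mul, norm_mul a] at h5
        have := mul_le_mul_of_nonneg_right hab (norm_nonneg f)
        linarith
      have h6 : N / k n * N = N ^ 2 * (k n)⁻¹ := by rw [div_eq_mul_inv]; ring
      have h7 : 0 ≤ N ^ 2 * (k n)⁻¹ := by positivity
      rw [h6] at h3
      by_contra hcon
      push Not at hcon
      nlinarith
    rcases le_total ‖a‖ ‖b‖ with hab | hab
    · have := gen a b _ hab h1 h2
      linarith [norm_nonneg (fourierCoeff q (2 * -k n))]
    · have := gen b a _ hab (by linarith) (h4 hE)
      linarith [norm_nonneg (fourierCoeff q (2 * k n))]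
  -- Here `a = O(1/k)`, so the trivial bound `N` on the Fourier coefficient is enough.
  · set δ := ‖Complex.exp (Complex.I * t) ^ 2 - 1‖ with hδ
    have hδ0 : 0 < δ := norm_pos_iff.2 (sub_ne_zero.2 hE)
    have l1 : Tendsto (fun n => N ^ 2 * (k n)⁻¹ + N * (N / (2 * δ) * (k n)⁻¹) +
        (N * (k n)⁻¹ + N / (2 * δ) * (k n)⁻¹) * Q) atTop (𝓝 0) := by
      simpa using ((hki.const_mul (N ^ 2)).add ((hki.const_mul (N / (2 * δ))).const_mul N)).add
        (((hki.const_mul N).add (hki.const_mul (N / (2 * δ)))).mul_const Q)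
    refine ge_of_tendsto l1 ?_
    filter_upwards [hcoef] with n hn
    obtain ⟨hpos, a, b, h1, h2, h3, -⟩ := hn
    have ha : ‖a‖ ≤ N / (2 * δ) * (k n)⁻¹ := by
      rw [mul_comm, ← le_div_iff₀ hδ0] at h3
      refine h3.trans (le_of_eq ?_)
      field_simp
    have hf : ‖fourierCoeff q (2 * k n)‖ ≤ N := by
      have := norm_integral_mul_le hq (C := 1)
        (f := fun x : ℝ => Complex.exp (Complex.I * (2 * k n : ℝ) * x))
        (fun x _ => (norm_exp_I_mul_mul _ _).le) (right_mem_Icc.2 zero_le_one)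
      rwa [one_mul] at this
    have h5 := norm_sub_le (b * fourierCoeff q 0 + a * fourierCoeff q (2 * k n))
      (a * fourierCoeff q (2 * k n))
    rw [add_sub_cancel_right, norm_mul, norm_mul a] at h5
    have h6 : N / k n * N = N ^ 2 * (k n)⁻¹ := by rw [div_eq_mul_inv]; ring
    have h7 : ‖a‖ * ‖fourierCoeff q (2 * k n)‖ ≤ N / (2 * δ) * (k n)⁻¹ * N :=
      mul_le_mul ha hf (norm_nonneg _) (by positivity)
    have h8 : 1 - N * (k n)⁻¹ - N / (2 * δ) * (k n)⁻¹ ≤ ‖b‖ := by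
      rw [div_eq_mul_inv N (k n)] at h1; linarith
    have h9 := mul_le_mul_of_nonneg_right h8 (norm_nonneg (fourierCoeff q 0))
    rw [← hQ] at h5 h9
    linarith

/-! ### The weak form and the first eigenvalue. -/

theorem intervalIntegral_eq_setIntegral_Icc {E : Type*} [NormedAddCommGroup E] [NormedSpace ℝ E]
    (f : ℝ → E) : ∫ x in (0 : ℝ)..1, f x = ∫ x in Icc (0 : ℝ) 1, f x := by
  rw [intervalIntegral.integral_of_le zero_le_one, integral_Icc_eq_integral_Ioc]

/-- The shifted quadratic form. -/
def quadForm (q : ℝ → ℝ) (c : ℝ) (y u : ℝ → ℂ) : ℝ :=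
  ∫ x in (0 : ℝ)..1, (‖u x‖ ^ 2 + (q x + c) * ‖y x‖ ^ 2)

/-- The weak form of the equation. -/
theorem Solves.integral_mul_conj {q : ℝ → ℝ} (hq : IntervalIntegrable q volume 0 1) {t c : ℝ}
    {y u g y' u' : ℝ → ℂ} (h : Solves t q y u (fun x => g x + (-c : ℂ) * y x))
    (hg : IntervalIntegrable g volume 0 1) (h' : IsC1 y' u')
    (hb : y' 1 = Complex.exp (Complex.I * t) * y' 0) :
    ∫ x in (0 : ℝ)..1, g x * conj (y' x) =
      ∫ x in (0 : ℝ)..1, (u x * conj (u' x) + (q x + c) * (y x * conj (y' x))) := by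
  have hI : uIcc (0 : ℝ) 1 = Icc 0 1 := uIcc_of_le zero_le_one
  have hs := solves_iff.1 h
  have hcy : ContinuousOn y (uIcc (0 : ℝ) 1) := by rw [hI]; exact hs.isC1.continuousOn
  have hcy' : ContinuousOn (fun x => conj (y' x)) (uIcc (0 : ℝ) 1) := by
    rw [hI]; exact h'.conj.continuousOn
  have iq := intervalIntegrable_ofReal hq
  have iw : IntervalIntegrable (fun x => q x * y x - (g x + (-c : ℂ) * y x)) volume 0 1 :=
    (iq.mul_continuousOn hcy).sub (hg.add (hcy.intervalIntegrable.const_mul _))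
  have i1 : IntervalIntegrable (fun x => u x * conj (u' x)) volume 0 1 :=
    ContinuousOn.intervalIntegrable (by rw [hI]; exact hs.isC1.2.mul h'.conj.2)
  have i2 : IntervalIntegrable (fun x => (q x + c : ℂ) * (y x * conj (y' x))) volume 0 1 :=
    (iq.add intervalIntegrable_const).mul_continuousOn (hcy.mul hcy')
  have key := hs.integral_mul_conj iw h' hb
  rw [intervalIntegral.integral_add i1 i2, ← sub_eq_iff_eq_add', ← neg_eq_iff_eq_neg.2 key,
    sub_neg_eq_add, ← intervalIntegral.integral_add (hg.mul_continuousOn hcy')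
      (iw.mul_continuousOn hcy')]
  refine intervalIntegral.integral_congr fun x _ => ?_
  ring

theorem Solves.integral_mul_conj_self {q : ℝ → ℝ} (hq : IntervalIntegrable q volume 0 1) {t c : ℝ}
    {y u g : ℝ → ℂ} (h : Solves t q y u (fun x => g x + (-c : ℂ) * y x))
    (hg : IntervalIntegrable g volume 0 1) :
    ∫ x in (0 : ℝ)..1, g x * conj (y x) = (quadForm q c y u : ℂ) := by
  have hs := solves_iff.1 h
  rw [h.integral_mul_conj hq hg hs.isC1 hs.bc, quadForm, ← intervalIntegral.integral_ofReal]
  refine intervalIntegral.integral_congr fun x _ => ?_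
  simp only [Complex.mul_conj', Complex.ofReal_add, Complex.ofReal_mul, Complex.ofReal_pow]

theorem IsC1.eq_zero_of_integral_le {y u : ℝ → ℂ} (h : IsC1 y u)
    (h0 : ∫ x in (0 : ℝ)..1, ‖y x‖ ^ 2 ≤ 0) : ∀ x ∈ Icc (0 : ℝ) 1, y x = 0 := by
  by_contra! hcon
  obtain ⟨x, hx, hne⟩ := hcon
  have := intervalIntegral.integral_pos zero_lt_one (h.continuousOn.norm.pow 2)
    (fun x _ => sq_nonneg ‖y x‖) ⟨x, hx, pow_pos (norm_pos_iff.2 hne) 2⟩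
  exact absurd this (not_lt.2 h0)

theorem L2_inner_eq (f g : L2) : inner ℂ f g = ∫ x in (0 : ℝ)..1, g x * conj (f x) := by
  rw [L2.inner_def, intervalIntegral_eq_setIntegral_Icc]
  rfl

theorem L2_inner_self (f : L2) : inner ℂ f f = ((‖f‖ ^ 2 : ℝ) : ℂ) := by
  rw [inner_self_eq_norm_sq_to_K]
  push_cast
  rfl

theorem L2_inner_eq_of_ae {f g : L2} {y : ℝ → ℂ}
    (hy : f =ᵐ[volume.restrict (Icc (0 : ℝ) 1)] y) :
    inner ℂ f g = ∫ x in (0 : ℝ)..1, g x * conj (y x) := by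
  rw [L2_inner_eq, intervalIntegral_eq_setIntegral_Icc, intervalIntegral_eq_setIntegral_Icc]
  refine integral_congr_ae ?_
  filter_upwards [hy] with x hx
  rw [hx]

theorem integral_norm_sq_eq_of_ae {f : L2} {y : ℝ → ℂ}
    (hy : f =ᵐ[volume.restrict (Icc (0 : ℝ) 1)] y) :
    ∫ x in (0 : ℝ)..1, ‖y x‖ ^ 2 = ‖f‖ ^ 2 := by
  have h1 := L2_inner_eq f f
  rw [L2_inner_self] at h1
  have h2 : ∫ x in (0 : ℝ)..1, f x * conj (f x) = ((∫ x in (0 : ℝ)..1, ‖y x‖ ^ 2 : ℝ) : ℂ) := by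
    rw [← intervalIntegral.integral_ofReal, intervalIntegral_eq_setIntegral_Icc,
      intervalIntegral_eq_setIntegral_Icc]
    refine integral_congr_ae ?_
    filter_upwards [hy] with x hx
    rw [hx, Complex.mul_conj', Complex.ofReal_pow]
  rw [h2] at h1
  exact_mod_cast h1.symm

theorem eq_of_solves {q : ℝ → ℝ} {t : ℝ} {z : ℂ}
    (hz : ∀ y u : ℝ → ℂ, Solves t q y u (fun x => z * y x) → ∀ x ∈ Icc (0 : ℝ) 1, y x = 0)
    {y u y' u' g : ℝ → ℂ} (h : Solves t q y u (fun x => g x + z * y x))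
    (h' : Solves t q y' u' (fun x => g x + z * y' x)) : ∀ x ∈ Icc (0 : ℝ) 1, y x = y' x :=
  fun x hx => sub_eq_zero.1 (hz _ _ ((h.sub h').congr_ae
    (Eventually.of_forall fun x => by ring)) x hx)

/-- A compact symmetric nonnegative operator attains its norm as an eigenvalue. -/
theorem exists_norm_eigenvector {E : Type*} [NormedAddCommGroup E] [InnerProductSpace ℂ E]
    [CompleteSpace E] {R : E →L[ℂ] E} (hc : IsCompactOperator R)
    (hpos : ∀ v, ∃ s : ℝ, 0 ≤ s ∧ inner ℂ (R v) v = s) (hne : R ≠ 0) :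
    ∃ v : E, v ≠ 0 ∧ R v = (‖R‖ : ℂ) • v := by
  have hsymm : (R : E →ₗ[ℂ] E).IsSymmetric := by
    rw [LinearMap.isSymmetric_iff_inner_map_self_real]
    intro v
    obtain ⟨s, -, hs⟩ := hpos v
    rw [ContinuousLinearMap.coe_coe, hs, Complex.conj_ofReal]
  have : Nontrivial (E →L[ℂ] E) := ⟨R, 0, hne⟩
  -- Self-adjointness gives a spectral value of modulus `‖R‖`, compactness makes it an eigenvalue,
  -- and nonnegativity identifies it with `‖R‖` itself.
  obtain ⟨k, hk, hkR⟩ := _root_.spectrum.exists_nnnorm_eq_spectralRadius R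
  rw [R.spectralRadius_eq_nnnorm hsymm.isSelfAdjoint, ENNReal.coe_inj] at hkR
  have hkR' : ‖k‖ = ‖R‖ := congrArg NNReal.toReal hkR
  have hk0 : k ≠ 0 := by
    rw [← norm_ne_zero_iff, hkR', norm_ne_zero_iff]; exact hne
  obtain ⟨v, hv⟩ := ((hc.hasEigenvalue_iff_mem_spectrum hk0).2 hk).exists_hasEigenvector
  have hv1 : R v = k • v := hv.apply_eq_smul
  refine ⟨v, hv.2, ?_⟩
  obtain ⟨s, hs0, hs⟩ := hpos v
  have hvn : 0 < ‖v‖ := norm_pos_iff.2 hv.2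
  rw [hv1, inner_smul_left, inner_self_eq_norm_sq_to_K] at hs
  have hk1 : conj k = ((s / ‖v‖ ^ 2 : ℝ) : ℂ) := by
    have : (‖v‖ : ℂ) ≠ 0 := by exact_mod_cast hvn.ne'
    push_cast
    rw [eq_div_iff (pow_ne_zero 2 this)]
    exact hs
  have hk2 : k = ((s / ‖v‖ ^ 2 : ℝ) : ℂ) := by
    rw [← Complex.conj_conj k, hk1, Complex.conj_ofReal]
  have hk3 : ‖k‖ = s / ‖v‖ ^ 2 := by
    rw [hk2, Complex.norm_real, Real.norm_eq_abs, abs_of_nonneg (by positivity)]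
  rw [hv1, ← hkR', hk3, ← hk2]

theorem isC1_exp (τ : ℝ) : IsC1 (fun x : ℝ => Complex.exp (Complex.I * τ * x))
    (fun x : ℝ => Complex.exp (Complex.I * τ * x) * (Complex.I * τ)) :=
  ⟨fun x _ => (hasDerivAt_exp_mul _ x).hasDerivWithinAt, by fun_prop⟩

/-- If the quadratic form is bounded below by the `L²` norm, testing it on `α y - f` bounds its
value on a solution `y` from below. -/
theorem one_le_mul_quadForm {q : ℝ → ℝ} (hq : IntervalIntegrable q volume 0 1) {t c α : ℝ}
    (hform : ∀ y u : ℝ → ℂ, IsC1 y u → ∫ x in (0 : ℝ)..1, ‖y x‖ ^ 2 ≤ quadForm q c y u)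
    {y u f v g : ℝ → ℂ} (h : Solves t q y u (fun x => g x + (-c : ℂ) * y x))
    (hg : IntervalIntegrable g volume 0 1) (hf : IsC1 f v)
    (hb : f 1 = Complex.exp (Complex.I * t) * f 0) (hα : 0 < α) (hfα : quadForm q c f v = α)
    (hgf : ∫ x in (0 : ℝ)..1, g x * conj (f x) = 1) : 1 ≤ α * quadForm q c y u := by
  have hI : uIcc (0 : ℝ) 1 = Icc 0 1 := uIcc_of_le zero_le_one
  have hy := (solves_iff.1 h).isC1
  have hd := hform _ _ ((hy.const_mul α).sub hf)
  have hn : 0 ≤ ∫ x in (0 : ℝ)..1, ‖(α : ℂ) * y x - f x‖ ^ 2 :=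
    intervalIntegral.integral_nonneg zero_le_one fun x _ => by positivity
  have hcross := h.integral_mul_conj hq hg hf hb
  rw [hgf] at hcross
  have iF : ∀ {y u : ℝ → ℂ}, IsC1 y u →
      IntervalIntegrable (fun x => ‖u x‖ ^ 2 + (q x + c) * ‖y x‖ ^ 2) volume 0 1 := by
    intro y u hy
    refine (ContinuousOn.intervalIntegrable (by rw [hI]; exact hy.2.norm.pow 2)).add
      ((hq.add intervalIntegrable_const).mul_continuousOn
        (by rw [hI]; exact hy.continuousOn.norm.pow 2))
  have iX : IntervalIntegrable (fun x => u x * conj (v x) + (q x + c) * (y x * conj (f x)))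
      volume 0 1 := by
    refine (ContinuousOn.intervalIntegrable (by rw [hI]; exact hy.2.mul hf.conj.2)).add
      (((intervalIntegrable_ofReal hq).add intervalIntegrable_const).mul_continuousOn
        (by rw [hI]; exact hy.continuousOn.mul hf.conj.continuousOn))
  have hre : ∫ x in (0 : ℝ)..1, (u x * conj (v x) + (q x + c) * (y x * conj (f x))).re = 1 := by
    have := Complex.reCLM.intervalIntegral_comp_comm iX
    rw [← hcross] at this
    simpa using this
  have iX' : IntervalIntegrable (fun x => (u x * conj (v x) + (q x + c) * (y x * conj (f x))).re)
      volume 0 1 := ⟨Complex.reCLM.integrable_comp iX.1, Complex.reCLM.integrable_comp iX.2⟩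
  -- The weak form makes the real part of the cross term `1`. Nonnegativity of `α² Q(y) - 2α + α`,
  -- with `Q` the form, is then the claim multiplied by `α`.
  have hexp : quadForm q c (fun x => (α : ℂ) * y x - f x) (fun x => (α : ℂ) * u x - v x) =
      α ^ 2 * quadForm q c y u - 2 * α * 1 + α := by
    rw [← hre, ← hfα, quadForm, quadForm, quadForm, ← intervalIntegral.integral_const_mul,
      ← intervalIntegral.integral_const_mul, ← intervalIntegral.integral_sub
        ((iF hy).const_mul _) (iX'.const_mul _), ← intervalIntegral.integral_add
        (((iF hy).const_mul _).sub (iX'.const_mul _)) (iF hf)]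
    refine intervalIntegral.integral_congr fun x _ => ?_
    simp only [← Complex.normSq_eq_norm_sq, Complex.normSq_apply, Complex.add_re, Complex.sub_re,
      Complex.sub_im, Complex.mul_re, Complex.mul_im, Complex.conj_re, Complex.conj_im,
      Complex.ofReal_re, Complex.ofReal_im, Complex.add_im]
    ring
  rw [hexp] at hd
  nlinarith

/-- If the quadratic form takes the value `α` on a unit vector `F` and the first eigenvalue of the
inverse operator is at most `α⁻¹`, then `F` is an eigenvector. -/
theorem eq_smul_of_norm_le {E : Type*} [NormedAddCommGroup E] [InnerProductSpace ℂ E]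
    {R : E →L[ℂ] E} {F : E} {α ρ : ℝ} (hα : 0 < α) (hF : ‖F‖ = 1) (hR : ‖R‖ ≤ α⁻¹)
    (hρ : inner ℂ (R F) F = ρ) (hαρ : 1 ≤ α * ρ) : R F = (α⁻¹ : ℂ) • F := by
  -- Equality case of Cauchy–Schwarz: the square expands to `‖R F‖² - 2 α⁻¹ ρ + α⁻²`, which is at
  -- most zero because `‖R F‖ ≤ α⁻¹ ≤ ρ`.
  have h1 := norm_sub_sq (𝕜 := ℂ) (R F) ((α⁻¹ : ℂ) • F)
  have h2 : ‖R F‖ ≤ α⁻¹ := (R.le_opNorm F).trans (by rwa [hF, mul_one])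
  have h3 : ‖(α⁻¹ : ℂ) • F‖ = α⁻¹ := by
    rw [norm_smul, hF, mul_one, norm_inv, Complex.norm_real, Real.norm_eq_abs, abs_of_pos hα]
  have h4 : RCLike.re (inner ℂ (R F) ((α⁻¹ : ℂ) • F)) = α⁻¹ * ρ := by
    rw [inner_smul_right, hρ, ← Complex.ofReal_inv, ← Complex.ofReal_mul]
    exact Complex.ofReal_re _
  rw [h3, h4] at h1
  have h5 : α⁻¹ * α⁻¹ ≤ α⁻¹ * ρ := by
    gcongr
    rwa [inv_le_iff_one_le_mul₀' hα]
  have h6 : ‖R F‖ ^ 2 ≤ α⁻¹ ^ 2 := by gcongr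
  have h7 : ‖R F - (α⁻¹ : ℂ) • F‖ ^ 2 ≤ 0 := by rw [h1]; nlinarith
  have h8 : ‖R F - (α⁻¹ : ℂ) • F‖ = 0 := by nlinarith [norm_nonneg (R F - (α⁻¹ : ℂ) • F)]
  exact sub_eq_zero.1 (norm_eq_zero.1 h8)

/-- The reciprocal of the norm of the resolvent gives the first eigenvalue. -/
theorem isFirstEigenvalue_of_resolvent {q : ℝ → ℝ} (hq : IntervalIntegrable q volume 0 1) {t c : ℝ}
    (hform : ∀ y u : ℝ → ℂ, IsC1 y u → ∫ x in (0 : ℝ)..1, ‖y x‖ ^ 2 ≤ quadForm q c y u)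
    (hz : ∀ y u : ℝ → ℂ, Solves t q y u (fun x => (-c : ℂ) * y x) →
      ∀ x ∈ Icc (0 : ℝ) 1, y x = 0)
    {R : L2 →L[ℂ] L2} (hc : IsCompactOperator R) (hR : ∀ g : L2, ∃ y u : ℝ → ℂ,
      Solves t q y u (fun x => g x + (-c : ℂ) * y x) ∧
      R g =ᵐ[volume.restrict (Icc (0 : ℝ) 1)] y) (hne : R ≠ 0) :
    IsFirstEigenvalue (L t q) (‖R‖⁻¹ - c) := by
  have hpos : ∀ v : L2, ∃ s : ℝ, 0 ≤ s ∧ inner ℂ (R v) v = s := by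
    intro v
    obtain ⟨y, u, h1, h2⟩ := hR v
    refine ⟨quadForm q c y u, le_trans ?_ (hform y u (solves_iff.1 h1).isC1), ?_⟩
    · exact intervalIntegral.integral_nonneg zero_le_one fun x _ => by positivity
    · rw [L2_inner_eq_of_ae h2, h1.integral_mul_conj_self hq (intervalIntegrable_L2 v)]
  have hRn : 0 < ‖R‖ := norm_pos_iff.2 hne
  have hRC : (‖R‖ : ℂ) ≠ 0 := by exact_mod_cast hRn.ne'
  constructor
  · obtain ⟨v, hv0, hv⟩ := exists_norm_eigenvector hc hpos hne
    obtain ⟨y, u, h1, h2⟩ := hR v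
    have h3 : Solves t q y u (((‖R‖⁻¹ - c : ℝ) : ℂ) • R v : L2) := h1.congr_ae (by
      filter_upwards [Lp.coeFn_smul (((‖R‖⁻¹ - c : ℝ) : ℂ)) (R v), h2,
        hv ▸ Lp.coeFn_smul (‖R‖ : ℂ) v] with x e1 e2 e3
      rw [e1, Pi.smul_apply, smul_eq_mul, ← e2, e3, Pi.smul_apply, smul_eq_mul]
      push_cast
      field_simp
      ring)
    obtain ⟨hd, e⟩ := L_apply_iff.2 ⟨y, u, h3, h2⟩
    refine ⟨⟨R v, hd⟩, ?_, e⟩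
    change R v ≠ 0
    rw [hv]
    exact smul_ne_zero hRC hv0
  -- For any eigenpair, `R` maps `(lam + c) f` to `f`. The form bound makes `lam + c` positive, so
  -- `1 ≤ ‖R‖ (lam + c)`.
  · rintro lam ⟨f, hf0, hf⟩
    obtain ⟨y, u, h1, h2⟩ := L_apply_iff.1 ⟨f.2, hf⟩
    set g : L2 := ((lam + c : ℝ) : ℂ) • (f : L2) with hg
    have h3 : Solves t q y u (fun x => g x + (-c : ℂ) * y x) := h1.congr_ae (by
      filter_upwards [Lp.coeFn_smul (lam : ℂ) (f : L2), h2,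
        Lp.coeFn_smul ((lam + c : ℝ) : ℂ) (f : L2)] with x e1 e2 e3
      rw [e1, e3, Pi.smul_apply, Pi.smul_apply, smul_eq_mul, smul_eq_mul, e2]
      push_cast
      ring)
    obtain ⟨y', u', h1', h2'⟩ := hR g
    have hRg : R g = f := by
      refine Lp.ext ?_
      filter_upwards [h2, h2', ae_restrict_mem measurableSet_Icc] with x e1 e2 hx
      rw [e1, e2, eq_of_solves hz h1' h3 x hx]
    have hfn : 0 < ‖(f : L2)‖ := norm_pos_iff.2 hf0
    have hlam : 0 < lam + c := by
      have e1 := h3.integral_mul_conj_self hq (intervalIntegrable_L2 g)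
      rw [← L2_inner_eq_of_ae h2, hg, inner_smul_right, L2_inner_self] at e1
      have e2 : (lam + c) * ‖(f : L2)‖ ^ 2 = quadForm q c y u := by exact_mod_cast e1
      have e3 := hform y u (solves_iff.1 h3).isC1
      rw [integral_norm_sq_eq_of_ae h2, ← e2] at e3
      by_contra hcon
      nlinarith [sq_pos_of_pos hfn]
    have h4 := R.le_opNorm g
    rw [hRg, hg, norm_smul, Complex.norm_real, Real.norm_eq_abs, abs_of_pos hlam] at h4
    have h5 : 1 ≤ ‖R‖ * (lam + c) := by
      by_contra hcon
      push Not at hcon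
      nlinarith
    rw [sub_le_iff_le_add, inv_le_iff_one_le_mul₀' hRn]
    exact h5

/-- If the test function `e^{iτx}` is an eigenfunction, the potential is constant. -/
theorem eq_sub_of_solves_exp {q : ℝ → ℝ} {t c α τ : ℝ} (hα : 0 < α) {y u g : ℝ → ℂ}
    (h : Solves t q y u (fun x => g x + (-c : ℂ) * y x))
    (hg : ∀ᵐ x ∂(volume.restrict (Icc (0 : ℝ) 1)), g x = Complex.exp (Complex.I * τ * x))
    (hy : ∀ᵐ x ∂(volume.restrict (Icc (0 : ℝ) 1)),
      y x = (α⁻¹ : ℂ) * Complex.exp (Complex.I * τ * x)) :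
    ∀ᵐ x ∂(volume.restrict (Icc (0 : ℝ) 1)), q x = α - c - τ ^ 2 := by
  have hs := solves_iff.1 h
  have hf := (isC1_exp τ).const_mul (α⁻¹ : ℂ)
  -- Continuity upgrades the almost everywhere identity to all of `[0,1]`. This determines `u` and
  -- its derivative, and the nonvanishing exponential cancels from the equation.
  have heq : EqOn y (fun x => (α⁻¹ : ℂ) * Complex.exp (Complex.I * τ * x)) (Icc (0 : ℝ) 1) :=
    Measure.eqOn_Icc_of_ae_eq volume zero_ne_one hy hs.isC1.continuousOn hf.continuousOn
  have hu : ∀ x ∈ Icc (0 : ℝ) 1,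
      u x = (α⁻¹ : ℂ) * (Complex.exp (Complex.I * τ * x) * (Complex.I * τ)) := fun x hx =>
    ((uniqueDiffOn_Icc zero_lt_one) x hx).eq_deriv _ (hs.deriv x hx)
      ((hf.1 x hx).congr heq (heq hx))
  filter_upwards [hs.ae, hg, ae_mem_Ioo] with x h1 h2 hx
  have h3 : HasDerivAt u ((α⁻¹ : ℂ) *
      (Complex.exp (Complex.I * τ * x) * (Complex.I * τ) * (Complex.I * τ))) x := by
    refine (((hasDerivAt_exp_mul (Complex.I * τ) x).mul_const _).const_mul
      (α⁻¹ : ℂ)).congr_of_eventuallyEq ?_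
    filter_upwards [Ioo_mem_nhds hx.1 hx.2] with s hs
    exact hu s (Ioo_subset_Icc_self hs)
  have h4 := h1.unique h3
  rw [h2, heq (Ioo_subset_Icc_self hx)] at h4
  have hα' : (α : ℂ) ≠ 0 := by exact_mod_cast hα.ne'
  have hE := Complex.exp_ne_zero (Complex.I * τ * x)
  have h5 : (q x : ℂ) = ((α - c - τ ^ 2 : ℝ) : ℂ) := by
    push_cast
    apply mul_left_cancel₀ hE
    apply mul_left_cancel₀ (inv_ne_zero hα')
    have e : (α : ℂ)⁻¹ * α = 1 := inv_mul_cancel₀ hα'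
    linear_combination h4 - Complex.exp (Complex.I * τ * x) * e +
      (α : ℂ)⁻¹ * Complex.exp (Complex.I * τ * x) * τ ^ 2 * Complex.I_sq
  exact_mod_cast h5

/-- Both `t` and `t - 2π` give the multiplier `e^{it}`; the one with the smaller square is taken. -/
theorem exists_min_exponent (t : ℝ) : ∃ τ : ℝ,
    τ ^ 2 = min (t ^ 2) ((2 * Real.pi - t) ^ 2) ∧
      Complex.exp (Complex.I * τ) = Complex.exp (Complex.I * t) := by
  rcases le_total (t ^ 2) ((2 * Real.pi - t) ^ 2) with h | h
  · exact ⟨t, (min_eq_left h).symm, rfl⟩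
  · refine ⟨t - 2 * Real.pi, by rw [min_eq_right h]; ring, ?_⟩
    rw [Complex.exp_eq_exp_iff_exists_int]
    exact ⟨-1, by push_cast; ring⟩

theorem quadForm_exp {q : ℝ → ℝ} (hq : IntervalIntegrable q volume 0 1) (c τ : ℝ) :
    quadForm q c (fun x => Complex.exp (Complex.I * τ * x))
      (fun x => Complex.exp (Complex.I * τ * x) * (Complex.I * τ)) =
      (∫ x in (0 : ℝ)..1, q x) + (τ ^ 2 + c) := by
  rw [quadForm]
  simp only [norm_mul, norm_exp_I_mul_mul, Complex.norm_I, Complex.norm_real, Real.norm_eq_abs,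
    one_mul, sq_abs, one_pow, mul_one]
  rw [intervalIntegral.integral_add intervalIntegrable_const
    (hq.add intervalIntegrable_const), intervalIntegral.integral_add hq intervalIntegrable_const]
  simp
  ring

end QuasiPeriodic

end

/-! ### Conclusion: the exponential as a minimizer. -/

theorem theorem1 (q : ℝ → ℝ) (hq : IntegrableOn q (Icc (0 : ℝ) 1))
    (t : ℝ) (ht : t ∈ Ico 0 (2 * Real.pi))
    (hfirst : ∀ lam : ℝ, QuasiPeriodic.IsFirstEigenvalue (QuasiPeriodic.L t q) lam →
      min (t ^ 2) ((2 * Real.pi - t) ^ 2) ≤ lam)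
    (hspec : ∀ n : ℕ, 1 ≤ n →
      (((2 * n * Real.pi - t) ^ 2 : ℝ) : ℂ) ∈ QuasiPeriodic.spectrum (QuasiPeriodic.L t q)) :
    ∀ᵐ x ∂(volume.restrict (Icc (0 : ℝ) 1)), q x = 0 := by
  open QuasiPeriodic in
  have iq : IntervalIntegrable q volume 0 1 := intervalIntegrable_zero_one_iff.2 hq
  have hmean := integral_eq_zero_of_spectrum iq t hspec
  obtain ⟨c, hc1, hform⟩ := exists_form_lower_bound iq
  have hz : ∀ y u : ℝ → ℂ, Solves t q y u (fun x => (-c : ℂ) * y x) →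
      ∀ x ∈ Icc (0 : ℝ) 1, y x = 0 := by
    intro y u h
    have h' : Solves t q y u (fun x => (fun _ => (0 : ℂ)) x + (-c : ℂ) * y x) := by
      simpa using h
    have h1 := h'.integral_mul_conj_self iq intervalIntegrable_const
    simp only [zero_mul, intervalIntegral.integral_zero] at h1
    have h2 : quadForm q c y u = 0 := by exact_mod_cast h1.symm
    exact (solves_iff.1 h).isC1.eq_zero_of_integral_le
      ((hform y u (solves_iff.1 h).isC1).trans h2.le)
  obtain ⟨R, hRc, hR⟩ := exists_compact_resolvent iq t (-c : ℂ) hz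
  obtain ⟨τ, hτ, hτt⟩ := exists_min_exponent t
  set f : ℝ → ℂ := fun x => Complex.exp (Complex.I * τ * x) with hf
  have hfm : MemLp f 2 (volume.restrict (Icc (0 : ℝ) 1)) :=
    MemLp.of_bound (by fun_prop) 1 (Filter.Eventually.of_forall fun x =>
      (norm_exp_I_mul_mul τ x).le)
  set F : L2 := hfm.toLp f with hF
  have hFf : F =ᵐ[volume.restrict (Icc (0 : ℝ) 1)] f := hfm.coeFn_toLp
  have hFn : ‖F‖ = 1 := by
    have h1 := integral_norm_sq_eq_of_ae hFf
    simp only [hf, norm_exp_I_mul_mul, one_pow, intervalIntegral.integral_const, sub_zero,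
      smul_eq_mul, mul_one] at h1
    nlinarith [norm_nonneg F]
  have hFF : ∫ x in (0 : ℝ)..1, F x * (starRingEnd ℂ) (f x) = 1 := by
    rw [← L2_inner_eq_of_ae hFf, inner_self_eq_norm_sq_to_K, hFn]; simp
  obtain ⟨y, u, hy, hRy⟩ := hR F
  have hα : 0 < τ ^ 2 + c := by positivity
  have hρ : inner ℂ (R F) F = ((quadForm q c y u : ℝ) : ℂ) := by
    rw [L2_inner_eq_of_ae hRy, hy.integral_mul_conj_self iq (intervalIntegrable_L2 F)]
  -- The zero mean enters here: it makes the shifted form of `e^{iτx}` exactly `τ² + c`.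
  have hle : 1 ≤ (τ ^ 2 + c) * quadForm q c y u :=
    one_le_mul_quadForm iq hform hy (intervalIntegrable_L2 F) (isC1_exp τ)
      (by simpa using hτt) hα (by rw [quadForm_exp iq, hmean, zero_add]) hFF
  have hRne : R ≠ 0 := by
    rintro rfl
    have h1 : quadForm q c y u = 0 := by exact_mod_cast (by simpa using hρ.symm)
    rw [h1] at hle
    norm_num at hle
  have hRn : ‖R‖ ≤ (τ ^ 2 + c)⁻¹ := by
    -- The number `‖R‖⁻¹ - c` is a first eigenvalue, so the hypothesis bounds it below by `τ²`. This
    -- is the converse inequality that forces equality in the variational estimate.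
    have h1 := hfirst _ (isFirstEigenvalue_of_resolvent iq hform hz hRc hR hRne)
    rw [← hτ, le_sub_iff_add_le] at h1
    exact (le_inv_comm₀ hα (norm_pos_iff.2 hRne)).1 h1
  have hRF := eq_smul_of_norm_le hα hFn hRn hρ hle
  have hq0 := eq_sub_of_solves_exp hα hy hFf (by
    have h1 := Lp.coeFn_smul ((τ ^ 2 + c : ℝ) : ℂ)⁻¹ F
    rw [← hRF] at h1
    filter_upwards [hRy, h1, hFf] with x e1 e2 e3
    rw [← e1, e2, Pi.smul_apply, e3, smul_eq_mul])
  filter_upwards [hq0] with x hx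
  rw [hx]; ring
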